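/- **Setting.** Let $G=(V,E)$ be a finite undirected graph with edge costs $c:E\to\mathbb{R}_{\ge 0}$, write $c(S)=\sum_{e\in S}c(e)$, and let $d$ be the shortest-path distance. A request is a pair of vertices; $S\subseteq E$ satisfies $(s,t)$ if it connects $s$ and $t$. A request sequence $R$ arrives online, and a prediction $\hat R$ (a finite list of pairs) is given in advance; $\mathrm{OPT}$ is the minimum of $c(S)$ over edge sets $S$ that satisfy all requests of $R$. The matching cost of $(s_1,t_1)$ and $(s_2,t_2)$ is $$\min\{d(s_1,s_2)+d(t_1,t_2),\ d(s_1,t_2)+d(s_2,t_1)\}.$$ A pair $(\Delta,D)$, with $D<\infty$, is a *metric error with outliers* of $\hat R$ with respect to $R$ if there are $M\subseteq R$ and $\hat M\subseteq\hat R$ with $|M|=|\hat M|$ such that a minimum-cost perfect matching of $M$ with $\hat M$ costs $D$, and $|R\setminus M|+|\hat R\setminus\hat M|=\Delta$. **Prize-collecting.** Given pairs and penalties $\pi\ge 0$ on them, the objective of $S\subseteq E$ is $c(S)$ plus the penalties of the pairs that $S$ does not satisfy. Let $\gamma\ge1$ and let $\mathrm{PC}$ be a (deterministic) $\gamma$-approximation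 for this problem on $G$. Write $\mathrm{PC}(\hat R,x)$ for its output when every pair of $\hat R$ has penalty $x$. **Online algorithm $\mathrm{ON}$** (Berman–Coulston style). Initially $F=\emptyset$ and $D_j=\emptyset$ for $j\in\mathbb Z$. When $(s,t)$ arrives, let $P$ be a shortest $s$–$t$ path, where edges of $F$ are free, let $p$ be its cost, and add $P$ to $F$. If $p=0$, stop. Otherwise let $\ell=\lfloor\log_2 p\rfloor$. Two open balls of radius $2^{\ell-2}$ intersect if the distance of their centres is less than $2\cdot 2^{\ell-2}$ (in $G$ with the costs that $\mathrm{ON}$ runs on). If for some $v\in\{s,t\}$ the ball $B(v,2^{\ell-2})$ intersects no ball in $D_\ell$, add $B(v,2^{\ell-2})$ to $D_\ell$ for one such $v$. Otherwise choose balls of $D_\ell$ with centres $a_1,a_2$ that intersect $B(s,2^{\ell-2})$ and $B(t,2^{\ell-2})$ respectively, and add to $F$ shortest $a_1$–$s$ and $a_2$–$t$ paths, where edges of $F$ are again free. All ties and choices are arbitrary. **Subroutine $\mathrm{Partial}(\hat R,u)$.** If $\gamma u\ge|\hat R|$, return $\emptyset$. Otherwise let $i$ be the minimum integer such that $\mathrm{PC}(\hat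 R,2^i)$ fails to satisfy at most $\gamma u$ pairs of $\hat R$; let $S_1=\mathrm{PC}(\hat R,2^{i-1})$, $S_2=\mathrm{PC}(\hat R,2^i)$, and let $u_1,u_2$ be the numbers of pairs of $\hat R$ that they do not satisfy. Return $S_1$ if $\gamma u\ge(u_1+u_2)/2$ and $S_2$ otherwise. **Framework.** Initially $B=\hat B=0$, $S=\emptyset$, and $\mathrm{ON}$ is a new instance on $G$. On each request, send it to $\mathrm{ON}$, add the edges that $\mathrm{ON}$ buys to $S$, and increase $B$ by the cost that $\mathrm{ON}$ incurred (in the costs that $\mathrm{ON}$ runs on). If then $B\ge 2\hat B$: set $\hat B:=B$, let $0\le u\le|\hat R|$ be minimum such that $c(\mathrm{Partial}(\hat R,u))\le 3\gamma\hat B$, add $\mathrm{Partial}(\hat R,u)$ to $S$, and start a new instance of $\mathrm{ON}$ on $G$ in which the edges of $S$ are free. Let $\mathrm{ALG}=c(S)$ for the final $S$. **Theorem.** For every $\gamma\ge 1$ there is a constant $C>0$, depending only on $\gamma$, such that for all $G$, $c$, $\mathrm{PC}$, $\hat R$ as above: 1. If every predicted pair is connected in $G$ and at positive distance, the framework is well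 defined: after any sequence of requests it can process every further request whose two vertices are connected in $G$. 2. For every request sequence $R$, every run of the framework on $R$ (for all choices that it leaves open) ends with a set $S\subseteq E$ that satisfies all requests of $R$, and simultaneously for every metric error with outliers $(\Delta,D)$ of $\hat R$ with respect to $R$, $$\mathrm{ALG}\le C\,\log\bigl(\min\{|R|,\Delta\}+2\bigr)\cdot\mathrm{OPT}+C\cdot D .$$ -/

import Mathlib

open scoped NNReal ENNReal

namespace SteinerForest

/-! ## Graphs with edge costs

Throughout, `G` is an undirected graph on `V` and `c e ≥ 0` is the cost of the edge `e`
(values of `c` outside the edge set of `G` play no role). A request is a pair of vertices, a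
sequence of requests is a list, and a solution is a finite set of edges. -/

/-- The total cost `c(S)` of a set of edges. -/
def cost {V : Type*} (c : Sym2 V → ℝ≥0) (S : Finset (Sym2 V)) : ℝ≥0 := ∑ e ∈ S, c e

/-- The edge costs in which the edges of `F` are free. -/
def zeroOn {V : Type*} [DecidableEq V] (c : Sym2 V → ℝ≥0) (F : Finset (Sym2 V)) :
    Sym2 V → ℝ≥0 := fun e => if e ∈ F then 0 else c e

/-- The cost of a walk. -/
def walkCost {V : Type*} {G : SimpleGraph V} (c : Sym2 V → ℝ≥0) {u v : V} (p : G.Walk u v) :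
    ℝ≥0 := (p.edges.map c).sum

/-- The shortest path distance in `G`; it is `∞` between different components. -/
noncomputable def gdist {V : Type*} (G : SimpleGraph V) (c : Sym2 V → ℝ≥0) (u v : V) : ℝ≥0∞ :=
  ⨅ p : G.Walk u v, (walkCost c p : ℝ≥0∞)

/-- `p` is a shortest path between its ends. -/
def IsShortestPath {V : Type*} {G : SimpleGraph V} (c : Sym2 V → ℝ≥0) {u v : V}
    (p : G.Walk u v) : Prop :=
  p.IsPath ∧ ∀ q : G.Walk u v, walkCost c p ≤ walkCost c q

/-- The edge set `S` satisfies the request `r`: it connects the two vertices of `r`. -/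
def Connects {V : Type*} (S : Finset (Sym2 V)) (r : V × V) : Prop :=
  (SimpleGraph.fromEdgeSet (S : Set (Sym2 V))).Reachable r.1 r.2

/-- `S` is a set of edges of `G` that connects every pair of `R`. -/
def IsFeasible {V : Type*} (G : SimpleGraph V) (R : List (V × V)) (S : Finset (Sym2 V)) : Prop :=
  (S : Set (Sym2 V)) ⊆ G.edgeSet ∧ ∀ r ∈ R, Connects S r

/-- `opt` is the cost of an optimal Steiner forest for `R`. -/
def IsOpt {V : Type*} (G : SimpleGraph V) (c : Sym2 V → ℝ≥0) (R : List (V × V)) (opt : ℝ≥0) :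
    Prop :=
  IsLeast {x | ∃ S, IsFeasible G R S ∧ x = cost c S} opt

/-! ## Metric error with outliers -/

/-- The cost of matching two pairs of vertices: the cheaper way of pairing up their ends. -/
noncomputable def matchCost {V : Type*} (G : SimpleGraph V) (c : Sym2 V → ℝ≥0) (r q : V × V) :
    ℝ≥0∞ :=
  min (gdist G c r.1 q.1 + gdist G c r.2 q.2) (gdist G c r.1 q.2 + gdist G c q.1 r.2)

/-- `(Δ, D)` is a metric error with outliers of the prediction `Rh` with respect to `R`: there
are equally large sets `A` of (positions of) requests and `Ah` of (positions of) predicted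
requests such that a minimum cost perfect matching between them costs `D`, and `Δ` is the total
number of requests and predictions left out. -/
def IsMetricError {V : Type*} (G : SimpleGraph V) (c : Sym2 V → ℝ≥0) (R Rh : List (V × V))
    (Δ : ℕ) (D : ℝ≥0) : Prop :=
  ∃ (A : Finset (Fin R.length)) (Ah : Finset (Fin Rh.length)),
    A.card = Ah.card ∧
    IsLeast {x : ℝ≥0∞ | ∃ f : A ≃ Ah,
      x = ∑ a : A, matchCost G c (R.get a.1) (Rh.get (f a).1)} (D : ℝ≥0∞) ∧
    Aᶜ.card + Ahᶜ.card = Δ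

/-! ## Prize-collecting Steiner forest -/

open Classical in
/-- The requests of `R` that `S` does not satisfy. -/
noncomputable def unsatisfied {V : Type*} (R : List (V × V)) (S : Finset (Sym2 V)) :
    List (V × V) := R.filter fun r => ¬ Connects S r

/-- The prize-collecting objective: the cost of `S` plus the penalties of the requests that `S`
does not satisfy. -/
noncomputable def prizeCost {V : Type*} (c : Sym2 V → ℝ≥0) (R : List (V × V)) (π : V × V → ℝ≥0)
    (S : Finset (Sym2 V)) : ℝ≥0 :=
  cost c S + ((unsatisfied R S).map π).sum

/-- `PC` is a `γ`-approximation for prize-collecting Steiner forest on `G` with costs `c`. -/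
structure IsPrizeCollectingApprox {V : Type*} (G : SimpleGraph V) (c : Sym2 V → ℝ≥0) (γ : ℝ≥0)
    (PC : List (V × V) → (V × V → ℝ≥0) → Finset (Sym2 V)) : Prop where
  subset : ∀ R π, (PC R π : Set (Sym2 V)) ⊆ G.edgeSet
  approx : ∀ R π (S : Finset (Sym2 V)), (S : Set (Sym2 V)) ⊆ G.edgeSet →
    prizeCost c R π (PC R π) ≤ γ * prizeCost c R π S

/-! ## The online algorithm for Steiner forest -/

/-- A state of the online algorithm: the bought edges `F`, and for each `j` the set `D j` of the
centres of the collected balls of radius `2 ^ (j - 2)`. -/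
structure OnState (V : Type*) where
  F : Finset (Sym2 V)
  D : ℤ → Finset V

/-- The initial state: nothing is bought and there are no balls. -/
def OnState.init (V : Type*) : OnState V := ⟨∅, fun _ => ∅⟩

/-- The open balls `B(a, 2 ^ (j - 2))` and `B(b, 2 ^ (j - 2))` intersect. -/
def BallsIntersect {V : Type*} (G : SimpleGraph V) (c : Sym2 V → ℝ≥0) (j : ℤ) (a b : V) : Prop :=
  gdist G c a b < (((2 : ℝ≥0) ^ (j - 2) + (2 : ℝ≥0) ^ (j - 2) : ℝ≥0) : ℝ≥0∞)

/-- The online algorithm may move from one state to another when the pair `(s, t)` arrives.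
In each case it buys a shortest path `p` from `s` to `t`, where bought edges are free; `ℓ` is the
scale of the cost of `p`. If `p` costs nothing there is no scale and no ball is considered. All
remaining choices (of shortest paths, of the end that gets a ball, of the intersecting balls) are
arbitrary. -/
inductive OnStep {V : Type*} [DecidableEq V] (G : SimpleGraph V) (c : Sym2 V → ℝ≥0) :
    OnState V → V × V → OnState V → Prop
  | free (σ : OnState V) (s t : V) (p : G.Walk s t)
      (hp : IsShortestPath (zeroOn c σ.F) p) (h0 : walkCost (zeroOn c σ.F) p = 0) :
      OnStep G c σ (s, t) ⟨σ.F ∪ p.edges.toFinset, σ.D⟩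
  | ball (σ : OnState V) (s t : V) (p : G.Walk s t)
      (hp : IsShortestPath (zeroOn c σ.F) p) (h0 : walkCost (zeroOn c σ.F) p ≠ 0)
      (ℓ : ℤ) (hℓ : ℓ = ⌊Real.logb 2 (walkCost (zeroOn c σ.F) p : ℝ)⌋)
      (v : V) (hv : v = s ∨ v = t) (hD : ∀ a ∈ σ.D ℓ, ¬ BallsIntersect G c ℓ a v) :
      OnStep G c σ (s, t)
        ⟨σ.F ∪ p.edges.toFinset, Function.update σ.D ℓ (insert v (σ.D ℓ))⟩
  | link (σ : OnState V) (s t : V) (p : G.Walk s t)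
      (hp : IsShortestPath (zeroOn c σ.F) p) (h0 : walkCost (zeroOn c σ.F) p ≠ 0)
      (ℓ : ℤ) (hℓ : ℓ = ⌊Real.logb 2 (walkCost (zeroOn c σ.F) p : ℝ)⌋)
      (a₁ a₂ : V) (ha₁ : a₁ ∈ σ.D ℓ) (ha₂ : a₂ ∈ σ.D ℓ)
      (hs : BallsIntersect G c ℓ a₁ s) (ht : BallsIntersect G c ℓ a₂ t)
      (q₁ : G.Walk a₁ s) (q₂ : G.Walk a₂ t)
      (hq₁ : IsShortestPath (zeroOn c (σ.F ∪ p.edges.toFinset)) q₁)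
      (hq₂ : IsShortestPath (zeroOn c (σ.F ∪ p.edges.toFinset)) q₂) :
      OnStep G c σ (s, t)
        ⟨σ.F ∪ p.edges.toFinset ∪ (q₁.edges.toFinset ∪ q₂.edges.toFinset), σ.D⟩

/-! ## The framework for online algorithms with predictions -/

/-- `T` is the set of edges returned by the subroutine `Partial(Rh, u)`. -/
def IsPartial {V : Type*} (γ : ℝ≥0) (PC : List (V × V) → (V × V → ℝ≥0) → Finset (Sym2 V))
    (Rh : List (V × V)) (u : ℕ) (T : Finset (Sym2 V)) : Prop :=
  let sol : ℤ → Finset (Sym2 V) := fun i => PC Rh fun _ => (2 : ℝ≥0) ^ i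
  let un : ℤ → ℝ≥0 := fun i => ((unsatisfied Rh (sol i)).length : ℝ≥0)
  ((Rh.length : ℝ≥0) ≤ γ * u ∧ T = ∅) ∨
  (γ * u < (Rh.length : ℝ≥0) ∧ ∃ i : ℤ, IsLeast {k : ℤ | un k ≤ γ * u} i ∧
    (((un (i - 1) + un i) / 2 ≤ γ * u ∧ T = sol (i - 1)) ∨
     (γ * u < (un (i - 1) + un i) / 2 ∧ T = sol i)))

/-- A state of the framework: the total cost `B` incurred by the online algorithm, the budget
`Bh`, the solution `S`, and the current instance of the online algorithm: it runs on the graph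
in which the edges of `S₀` are free, and it is in the state `on`. -/
structure State (V : Type*) where
  B : ℝ≥0
  Bh : ℝ≥0
  S : Finset (Sym2 V)
  S₀ : Finset (Sym2 V)
  on : OnState V

/-- The initial state of the framework. -/
def State.init (V : Type*) : State V := ⟨0, 0, ∅, ∅, OnState.init V⟩

/-- The framework, with prize-collecting algorithm `PC` and prediction `Rh`, may move from one
state to another when the request `r` arrives. In a major step, `u` is the least number for which
the output of `Partial(Rh, u)` costs at most `3 γ` times the new budget. -/
inductive Step {V : Type*} [DecidableEq V] (G : SimpleGraph V) (c : Sym2 V → ℝ≥0) (γ : ℝ≥0)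
    (PC : List (V × V) → (V × V → ℝ≥0) → Finset (Sym2 V)) (Rh : List (V × V)) :
    State V → V × V → State V → Prop
  | minor (σ : State V) (r : V × V) (on' : OnState V) (B' : ℝ≥0)
      (hon : OnStep G (zeroOn c σ.S₀) σ.on r on')
      (hB : B' = σ.B + cost (zeroOn c σ.S₀) (on'.F \ σ.on.F))
      (hlt : B' < 2 * σ.Bh) :
      Step G c γ PC Rh σ r ⟨B', σ.Bh, σ.S ∪ on'.F, σ.S₀, on'⟩
  | major (σ : State V) (r : V × V) (on' : OnState V) (B' : ℝ≥0)
      (hon : OnStep G (zeroOn c σ.S₀) σ.on r on')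
      (hB : B' = σ.B + cost (zeroOn c σ.S₀) (on'.F \ σ.on.F))
      (hge : 2 * σ.Bh ≤ B')
      (u : ℕ) (T : Finset (Sym2 V)) (hu : u ≤ Rh.length)
      (hT : IsPartial γ PC Rh u T) (hcT : cost c T ≤ 3 * γ * B')
      (hmin : ∀ u' < u, ∃ T', IsPartial γ PC Rh u' T' ∧ 3 * γ * B' < cost c T') :
      Step G c γ PC Rh σ r
        ⟨B', B', σ.S ∪ on'.F ∪ T, σ.S ∪ on'.F ∪ T, OnState.init V⟩

/-- `Run G c γ PC Rh σ R σ'`: serving the request sequence `R` from the state `σ`, the framework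
may end in the state `σ'`. -/
inductive Run {V : Type*} [DecidableEq V] (G : SimpleGraph V) (c : Sym2 V → ℝ≥0) (γ : ℝ≥0)
    (PC : List (V × V) → (V × V → ℝ≥0) → Finset (Sym2 V)) (Rh : List (V × V)) :
    State V → List (V × V) → State V → Prop
  | nil (σ : State V) : Run G c γ PC Rh σ [] σ
  | cons (σ σ' σ'' : State V) (r : V × V) (R : List (V × V))
      (hstep : Step G c γ PC Rh σ r σ') (hrun : Run G c γ PC Rh σ' R σ'') :
      Run G c γ PC Rh σ (r :: R) σ''

end SteinerForest

/-! The proof rests on a subset-competitive analysis of `ON` (`onRun_sum_cost_le`): for every set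
`P` of requests of one instance, the steps serving `P` cost O(log |P|) times any solution `S` of the
whole instance. A step on scale `ℓ` costs at most `3 * 2 ^ ℓ`. It either creates a ball or merges
two components of `F` that meet the centres of `D ℓ`, so there are at most `2 * |D ℓ|` of them. The
balls are disjoint, and `S` must leave each one, so `|D ℓ| * 2 ^ (ℓ - 2) ≤ c(S)`
(`card_mul_le_cost`). Hence each scale contributes O(c(S)), no scale exceeds c(S), and scales more
than about log |P| below the top are negligible.

The framework pays at most `(2 + 6γ)` times its last budget, because budgets double and the costs of
the partial solutions form a geometric sum. It remains to bound the budget (`Run.cost_le`).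
Extending an optimal solution along the matching gives a set of cost at most `OPT + D` that misses
at most `Δ` predictions. So once the budget reaches `OPT + D`, the partial solution is computed with
`u ≤ Δ` and misses at most `2γΔ` predictions (`IsPartial.cost_le`, `IsPartial.unsatisfied_le`).

In the phase that follows, a request matched with a satisfied prediction costs at most twice its
matching cost, since the prediction is a free shortcut. These requests pay O(D) together. All others
number at most `(1 + 2γ)Δ`, and the subset bound applies to them (`OnRunTo.le_of_matching`). A phase
costing at most `Z` can only end with a budget of at most `2Z`, because the budget has doubled.
Taking all requests as the subset gives the bound in `|R|` in the same way. -/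

namespace SteinerForest

variable {V : Type*}

/-! ## Walks and distances -/

section Walks

variable {G : SimpleGraph V} {c c' : Sym2 V → ℝ≥0}

lemma walkCost_append {u v w : V} (p : G.Walk u v) (q : G.Walk v w) :
    walkCost c (p.append q) = walkCost c p + walkCost c q := by
  simp [walkCost]

lemma walkCost_reverse {u v : V} (p : G.Walk u v) : walkCost c p.reverse = walkCost c p := by
  simp [walkCost, List.sum_reverse]

lemma walkCost_mono (h : c ≤ c') {u v : V} (p : G.Walk u v) : walkCost c p ≤ walkCost c' p :=
  List.sum_le_sum fun e _ => h e

lemma zeroOn_le [DecidableEq V] (c : Sym2 V → ℝ≥0) (F : Finset (Sym2 V)) : zeroOn c F ≤ c := by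
  intro e
  unfold zeroOn
  split_ifs <;> simp

lemma gdist_le_walkCost {u v : V} (p : G.Walk u v) : gdist G c u v ≤ walkCost c p :=
  iInf_le _ p

lemma gdist_self (v : V) : gdist G c v v = 0 :=
  le_antisymm ((gdist_le_walkCost SimpleGraph.Walk.nil).trans (by simp [walkCost])) zero_le

lemma gdist_comm_le (u v : V) : gdist G c u v ≤ gdist G c v u :=
  le_iInf fun p => (gdist_le_walkCost p.reverse).trans (by rw [walkCost_reverse])

lemma gdist_comm (u v : V) : gdist G c u v = gdist G c v u :=
  le_antisymm (gdist_comm_le u v) (gdist_comm_le v u)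

lemma gdist_triangle (u v w : V) : gdist G c u w ≤ gdist G c u v + gdist G c v w := by
  refine ENNReal.le_iInf_add_iInf fun p q => ?_
  rw [← ENNReal.coe_add, ← walkCost_append]
  exact gdist_le_walkCost _

lemma gdist_mono (h : c ≤ c') (u v : V) : gdist G c u v ≤ gdist G c' u v :=
  iInf_mono fun p => by exact_mod_cast walkCost_mono h p

lemma gdist_le_of_adj {u v : V} (h : G.Adj u v) : gdist G c u v ≤ c s(u, v) :=
  (gdist_le_walkCost h.toWalk).trans (by simp [walkCost])

lemma reachable_of_gdist_ne_top {u v : V} (h : gdist G c u v ≠ ∞) : G.Reachable u v := by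
  by_contra hn
  have : IsEmpty (G.Walk u v) := ⟨fun p => hn ⟨p⟩⟩
  exact h (by simp [gdist])

lemma sum_edges_le_of_isPath [DecidableEq V] {u v : V} {p : G.Walk u v} (hp : p.IsPath)
    {S : Finset (Sym2 V)} (hS : ∀ e ∈ p.edges, e ∈ S) : walkCost c p ≤ cost c S := by
  have hnd : p.edges.Nodup := hp.isTrail.edges_nodup
  rw [walkCost, ← List.sum_toFinset _ hnd, cost]
  exact Finset.sum_le_sum_of_subset fun e he => hS e (by simpa using he)

lemma IsShortestPath.walkCost_eq {u v : V} {p : G.Walk u v} (hp : IsShortestPath c p) :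
    (walkCost c p : ℝ≥0∞) = gdist G c u v :=
  le_antisymm (le_iInf fun q => by exact_mod_cast hp.2 q) (gdist_le_walkCost p)

lemma walkCost_bypass_le [DecidableEq V] {u v : V} (p : G.Walk u v) :
    walkCost c p.bypass ≤ walkCost c p :=
  (p.edges_bypass_sublist_edges.map c).sum_le_sum fun _ _ => zero_le

lemma exists_isShortestPath [Fintype V] [DecidableEq V] (c : Sym2 V → ℝ≥0) {u v : V}
    (h : G.Reachable u v) : ∃ p : G.Walk u v, IsShortestPath c p := by
  classical
  obtain ⟨p₀⟩ := h
  have : Nonempty (G.Path u v) := ⟨p₀.toPath⟩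
  obtain ⟨p, hp⟩ := Finite.exists_min fun p : G.Path u v => walkCost c p.1
  exact ⟨p.1, p.2, fun q => (hp q.toPath).trans (walkCost_bypass_le q)⟩

lemma cost_edges_sdiff_le [DecidableEq V] {u v : V} {p : G.Walk u v} (hp : p.IsPath)
    (F : Finset (Sym2 V)) : cost c (p.edges.toFinset \ F) ≤ walkCost (zeroOn c F) p := by
  rw [walkCost, ← List.sum_toFinset _ hp.isTrail.edges_nodup, cost]
  calc ∑ e ∈ p.edges.toFinset \ F, c e = ∑ e ∈ p.edges.toFinset \ F, zeroOn c F e :=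
        Finset.sum_congr rfl fun e he => by simp [zeroOn, (Finset.mem_sdiff.1 he).2]
    _ ≤ _ := Finset.sum_le_sum_of_subset Finset.sdiff_subset

lemma cost_mono {S T : Finset (Sym2 V)} (h : S ⊆ T) : cost c S ≤ cost c T :=
  Finset.sum_le_sum_of_subset h

lemma cost_union_le [DecidableEq V] (S T : Finset (Sym2 V)) :
    cost c (S ∪ T) ≤ cost c S + cost c T := by
  rw [cost, cost, cost, ← Finset.sum_union_inter]
  exact le_self_add

lemma cost_le_cost (h : c ≤ c') (S : Finset (Sym2 V)) : cost c S ≤ cost c' S :=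
  Finset.sum_le_sum fun e _ => h e

end Walks

/-! ## Connection by a set of edges -/

section Connects

variable {G : SimpleGraph V} {c : Sym2 V → ℝ≥0} {S T : Finset (Sym2 V)}

lemma Connects.mono (h : S ⊆ T) {r : V × V} (hr : Connects S r) : Connects T r :=
  SimpleGraph.Reachable.mono (SimpleGraph.fromEdgeSet_mono (by exact_mod_cast h)) hr

lemma Connects.symm {u v : V} (h : Connects S (u, v)) : Connects S (v, u) :=
  SimpleGraph.Reachable.symm h

lemma Connects.trans {u v w : V} (h : Connects S (u, v)) (h' : Connects S (v, w)) :
    Connects S (u, w) :=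
  SimpleGraph.Reachable.trans h h'

lemma connects_of_walk [DecidableEq V] {u v : V} (p : G.Walk u v)
    (h : p.edges.toFinset ⊆ S) : Connects S (u, v) := by
  refine ⟨p.transfer _ fun e he => ?_⟩
  rw [SimpleGraph.edgeSet_fromEdgeSet]
  exact ⟨h (by simpa using he), G.not_isDiag_of_mem_edgeSet (p.edges_subset_edgeSet he)⟩

lemma Connects.exists_path [DecidableEq V] (hS : (S : Set (Sym2 V)) ⊆ G.edgeSet) {u v : V}
    (h : Connects S (u, v)) : ∃ p : G.Walk u v, p.IsPath ∧ ∀ e ∈ p.edges, e ∈ S := by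
  obtain ⟨p⟩ := h
  have hp : ∀ e ∈ p.bypass.edges, e ∈ S := fun e he => by
    have := p.bypass.edges_subset_edgeSet he
    rw [SimpleGraph.edgeSet_fromEdgeSet] at this
    exact this.1
  exact ⟨p.bypass.transfer G fun e he => hS (hp e he), p.bypass_isPath.transfer _, by simpa using hp⟩

lemma Connects.gdist_le [DecidableEq V] (hS : (S : Set (Sym2 V)) ⊆ G.edgeSet) {u v : V}
    (h : Connects S (u, v)) : gdist G c u v ≤ cost c S := by
  obtain ⟨p, hp, hpS⟩ := h.exists_path hS
  exact (gdist_le_walkCost p).trans (by exact_mod_cast sum_edges_le_of_isPath hp hpS)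

lemma Connects.gdist_zeroOn [DecidableEq V] (hS : (S : Set (Sym2 V)) ⊆ G.edgeSet) {u v : V}
    (h : Connects S (u, v)) (hST : S ⊆ T) : gdist G (zeroOn c T) u v = 0 := by
  refine le_antisymm ((h.gdist_le hS).trans ?_) zero_le
  rw [cost, Finset.sum_eq_zero fun e he => by simp [zeroOn, hST he]]
  simp

end Connects

/-! ## Sums of costs with few summands on each scale -/

/-- Let `2 ^ L` be the largest power of two below `X`, and `|I| ≤ 2 ^ m`. The summands on levels at
most `L - m` are so small that all of them together give `3X`. Each of the `m` levels above gives at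
most `24X` by the count. -/
lemma sum_le_log_of_card_level_le {ι : Type*} (I : Finset ι) (x : ι → ℝ) (lvl : ι → ℤ) {X : ℝ}
    (hX : 0 ≤ X) (hx : ∀ i ∈ I, x i ≤ 3 * 2 ^ lvl i) (hle : ∀ i ∈ I, (2 : ℝ) ^ lvl i ≤ X)
    (hcard : ∀ ℓ : ℤ, ((I.filter (lvl · = ℓ)).card : ℝ) * 2 ^ ℓ ≤ 8 * X) :
    ∑ i ∈ I, x i ≤ 100 * Real.log (I.card + 2) * X := by
  have hlog : 0 ≤ Real.log ((I.card : ℝ) + 2) :=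
    Real.log_nonneg (by have : (0 : ℝ) ≤ I.card := by positivity
                        linarith)
  rcases I.eq_empty_or_nonempty with rfl | ⟨i₀, hi₀⟩
  · simp only [Finset.sum_empty]; positivity
  have hXpos : 0 < X := lt_of_lt_of_le (by positivity) (hle i₀ hi₀)
  set k := I.card with hk
  have hkpos : 0 < k := Finset.card_pos.2 ⟨i₀, hi₀⟩
  set m := Nat.log 2 k + 1 with hm
  have hkm : (k : ℝ) ≤ 2 ^ m := by exact_mod_cast (Nat.lt_pow_succ_log_self one_lt_two k).le
  set L := Int.log 2 X with hL
  have hLX : (2 : ℝ) ^ L ≤ X := by exact_mod_cast Int.zpow_log_le_self (b := 2) one_lt_two hXpos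
  have hlvl : ∀ i ∈ I, lvl i ≤ L := fun i hi => by
    rw [hL, ← Int.zpow_le_iff_le_log one_lt_two hXpos]
    exact_mod_cast hle i hi
  rw [← Finset.sum_filter_add_sum_filter_not I fun i => lvl i ≤ L - m]
  have h₁ : ∑ i ∈ I with lvl i ≤ L - m, x i ≤ 3 * X := by
    calc ∑ i ∈ I with lvl i ≤ L - m, x i ≤ ∑ i ∈ I with lvl i ≤ L - m, 3 * (2 : ℝ) ^ (L - m) :=
          Finset.sum_le_sum fun i hi => by
            rw [Finset.mem_filter] at hi
            refine (hx i hi.1).trans ?_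
            gcongr
            · norm_num
            · exact hi.2
      _ ≤ k * (3 * (2 : ℝ) ^ (L - m)) := by
          rw [Finset.sum_const, nsmul_eq_mul]
          gcongr
          exact Finset.card_filter_le _ _
      _ ≤ 2 ^ m * (3 * (2 : ℝ) ^ (L - m)) := by gcongr
      _ = 3 * 2 ^ L := by
          rw [zpow_sub₀ two_ne_zero, zpow_natCast]
          field_simp
      _ ≤ 3 * X := by gcongr
  have h₂ : ∑ i ∈ I with ¬ lvl i ≤ L - m, x i ≤ m * (24 * X) := by
    have hmaps : ∀ i ∈ I.filter fun i => ¬ lvl i ≤ L - m, lvl i ∈ Finset.Ioc (L - m) L := by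
      intro i hi
      rw [Finset.mem_filter] at hi
      exact Finset.mem_Ioc.2 ⟨not_le.1 hi.2, hlvl i hi.1⟩
    rw [← Finset.sum_fiberwise_of_maps_to hmaps]
    calc _ ≤ ∑ ℓ ∈ Finset.Ioc (L - m) L, 24 * X := Finset.sum_le_sum fun ℓ _ => ?_
      _ = m * (24 * X) := by simp
    rw [Finset.filter_filter]
    calc ∑ i ∈ I with ¬ lvl i ≤ L - m ∧ lvl i = ℓ, x i
        ≤ ∑ i ∈ I with ¬ lvl i ≤ L - m ∧ lvl i = ℓ, 3 * (2 : ℝ) ^ ℓ :=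
          Finset.sum_le_sum fun i hi => by
            rw [Finset.mem_filter] at hi
            exact hi.2.2 ▸ hx i hi.1
      _ ≤ (I.filter (lvl · = ℓ)).card * (3 * (2 : ℝ) ^ ℓ) := by
          rw [Finset.sum_const, nsmul_eq_mul]
          gcongr
          exact fun h => h.2
      _ ≤ 24 * X := by linarith [hcard ℓ]
  have hlog2 : 0.69 ≤ Real.log ((k : ℝ) + 2) :=
    le_trans (by linarith [Real.log_two_gt_d9])
      (Real.log_le_log two_pos (by have : (0 : ℝ) ≤ k := by positivity
                                   linarith))
  have hmlog : ((Nat.log 2 k : ℕ) : ℝ) * 0.69 ≤ Real.log (k + 2) := by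
    have h := Real.natLog_le_logb k 2
    rw [Real.logb, le_div_iff₀ (by simpa using Real.log_pos one_lt_two)] at h
    have h' : Real.log k ≤ Real.log (k + 2) := Real.log_le_log (by exact_mod_cast hkpos) (by linarith)
    refine le_trans ?_ (h.trans h')
    gcongr
    push_cast
    linarith [Real.log_two_gt_d9]
  -- The left side is `27 + 24 * Nat.log 2 k`; by the two bounds with 0.69 it is below `(40 + 35) *
  -- log (k + 2)`.
  have : (3 : ℝ) + m * 24 ≤ 100 * Real.log (k + 2) := by
    rw [hm]
    push_cast
    linarith
  calc _ ≤ (3 + (m : ℝ) * 24) * X := by linarith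
    _ ≤ _ := by gcongr

/-! ## Packing balls into a solution -/

section Packing

/-- For an edge of length `d`, `a v` and `b v` are the depths of its two ends in the ball around
`v`. Each end lies in at most one ball, so at most two summands survive. If there are two, the ends
lie in different balls and `hne` applies. -/
lemma sum_abs_sub_le_of_almost_disjoint {ι : Type*} (D : Finset ι) (a b : ι → ℝ) {d : ℝ}
    (hd : 0 ≤ d) (ha₀ : ∀ v ∈ D, 0 ≤ a v) (hb₀ : ∀ v ∈ D, 0 ≤ b v)
    (ha : ∀ v ∈ D, ∀ w ∈ D, a v ≠ 0 → a w ≠ 0 → v = w)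
    (hb : ∀ v ∈ D, ∀ w ∈ D, b v ≠ 0 → b w ≠ 0 → v = w)
    (hab : ∀ v ∈ D, |a v - b v| ≤ d)
    (hne : ∀ v ∈ D, ∀ w ∈ D, v ≠ w → a v ≠ 0 → b w ≠ 0 → a v + b w ≤ d) :
    ∑ v ∈ D, |a v - b v| ≤ d := by
  by_cases h₁ : ∃ v ∈ D, a v ≠ 0
  · obtain ⟨v, hv, hav⟩ := h₁
    have hav' : ∀ w ∈ D, w ≠ v → a w = 0 := fun w hw hwv => by
      by_contra h
      exact hwv (ha w hw v hv h hav)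
    by_cases h₂ : ∃ w ∈ D, w ≠ v ∧ b w ≠ 0
    · obtain ⟨w, hw, hwv, hbw⟩ := h₂
      have hbw' : ∀ u ∈ D, u ≠ w → b u = 0 := fun u hu huw => by
        by_contra h
        exact huw (hb u hu w hw h hbw)
      rw [Finset.sum_eq_add v w hwv.symm
        (fun u hu hne => by rw [hav' u hu hne.1, hbw' u hu hne.2]; simp)
        (fun h => absurd hv h) (fun h => absurd hw h), hav' w hw hwv, hbw' v hv hwv.symm,
        sub_zero, zero_sub, abs_neg, abs_of_nonneg (ha₀ v hv), abs_of_nonneg (hb₀ w hw)]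
      exact hne v hv w hw hwv.symm hav hbw
    · push Not at h₂
      rw [Finset.sum_eq_single_of_mem v hv fun w hw hwv => by
        rw [hav' w hw hwv, h₂ w hw hwv]; simp]
      exact hab v hv
  · push Not at h₁
    by_cases h₂ : ∃ w ∈ D, b w ≠ 0
    · obtain ⟨w, hw, hbw⟩ := h₂
      rw [Finset.sum_eq_single_of_mem w hw fun u hu huw => by
        rw [h₁ u hu]
        by_cases h : b u = 0
        · simp [h]
        · exact absurd (hb u hu w hw h hbw) huw]
      exact hab w hw
    · push Not at h₂
      rw [Finset.sum_eq_zero fun u hu => by rw [h₁ u hu, h₂ u hu]; simp]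
      exact hd

variable {G : SimpleGraph V} {c : Sym2 V → ℝ≥0}

/-- How deep `x` lies in the ball of radius `ρ` around `v`. -/
noncomputable def depth (G : SimpleGraph V) (c : Sym2 V → ℝ≥0) (ρ : ℝ≥0) (v x : V) : ℝ :=
  ((ρ : ℝ≥0∞) - gdist G c v x).toReal

lemma depth_nonneg (ρ : ℝ≥0) (v x : V) : 0 ≤ depth G c ρ v x := ENNReal.toReal_nonneg

lemma depth_self (ρ : ℝ≥0) (v : V) : depth G c ρ v v = ρ := by simp [depth, gdist_self]

lemma depth_eq_zero {ρ : ℝ≥0} {v x : V} (h : (ρ : ℝ≥0∞) ≤ gdist G c v x) :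
    depth G c ρ v x = 0 := by simp [depth, tsub_eq_zero_of_le h]

lemma gdist_add_depth {ρ : ℝ≥0} {v x : V} (h : depth G c ρ v x ≠ 0) :
    gdist G c v x < ρ ∧ (gdist G c v x).toReal + depth G c ρ v x = ρ := by
  have hlt : gdist G c v x < ρ := by
    by_contra hn
    exact h (depth_eq_zero (not_lt.1 hn))
  refine ⟨hlt, ?_⟩
  rw [depth, ENNReal.toReal_sub_of_le hlt.le ENNReal.coe_ne_top]
  simp

lemma depth_le_add {ρ : ℝ≥0} {v x y : V} (h : G.Adj x y) :
    depth G c ρ v x ≤ depth G c ρ v y + c s(x, y) := by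
  have hne : ∀ z, (ρ : ℝ≥0∞) - gdist G c v z ≠ ∞ := fun z =>
    (tsub_le_self.trans_lt ENNReal.coe_lt_top).ne
  have : (ρ : ℝ≥0∞) - gdist G c v x ≤ (ρ - gdist G c v y) + c s(x, y) := by
    rw [tsub_le_iff_right, add_assoc]
    refine (le_tsub_add (a := gdist G c v y)).trans ?_
    gcongr
    rw [add_comm]
    exact (gdist_triangle v x y).trans (by gcongr; exact gdist_le_of_adj h)
  have := ENNReal.toReal_mono (by simp [hne]) this
  rwa [ENNReal.toReal_add (hne y) ENNReal.coe_ne_top] at this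

lemma abs_depth_sub_le {ρ : ℝ≥0} {v x y : V} (h : G.Adj x y) :
    |depth G c ρ v x - depth G c ρ v y| ≤ c s(x, y) := by
  have h₁ := depth_le_add (c := c) (ρ := ρ) (v := v) h
  have h₂ := depth_le_add (c := c) (ρ := ρ) (v := v) h.symm
  rw [Sym2.eq_swap] at h₂
  rw [abs_le]
  constructor <;> linarith

/-- The route from `v` through `x` and `y` to `w` has length at least `2ρ`, and the two depths are
exactly what its outer pieces lack to `ρ` each. -/
lemma depth_add_depth_le {ρ : ℝ≥0} {v w x y : V}
    (hvw : ((ρ + ρ : ℝ≥0) : ℝ≥0∞) ≤ gdist G c v w) {d : ℝ≥0} (hxy : gdist G c x y ≤ d)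
    (hx : depth G c ρ v x ≠ 0) (hy : depth G c ρ w y ≠ 0) :
    depth G c ρ v x + depth G c ρ w y ≤ d := by
  obtain ⟨hx₁, hx₂⟩ := gdist_add_depth hx
  obtain ⟨hy₁, hy₂⟩ := gdist_add_depth hy
  have h : ((ρ + ρ : ℝ≥0) : ℝ≥0∞) ≤ gdist G c v x + d + gdist G c w y := by
    refine hvw.trans ((gdist_triangle v y w).trans ?_)
    rw [gdist_comm y w]
    gcongr
    exact (gdist_triangle v x y).trans (by gcongr)
  have h := ENNReal.toReal_mono (by simp [hx₁.ne_top, hy₁.ne_top]) h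
  rw [ENNReal.toReal_add (by simp [hx₁.ne_top]) hy₁.ne_top,
    ENNReal.toReal_add hx₁.ne_top (by simp)] at h
  simp only [ENNReal.coe_toReal, NNReal.coe_add] at h
  linarith

/-- The variation of the depth in the ball around `v` along an edge. -/
noncomputable def depthVar (G : SimpleGraph V) (c : Sym2 V → ℝ≥0) (ρ : ℝ≥0) (v : V) :
    Sym2 V → ℝ :=
  Sym2.lift ⟨fun x y => |depth G c ρ v x - depth G c ρ v y|, fun _ _ => abs_sub_comm _ _⟩

lemma depthVar_nonneg (ρ : ℝ≥0) (v : V) (e : Sym2 V) : 0 ≤ depthVar G c ρ v e := by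
  induction e with
  | _ x y => exact abs_nonneg _

lemma depth_sub_le_sum_depthVar (ρ : ℝ≥0) (v : V) {x y : V} (p : G.Walk x y) :
    depth G c ρ v x - depth G c ρ v y ≤ (p.edges.map (depthVar G c ρ v)).sum := by
  induction p with
  | nil => simp
  | @cons x y z h p ih =>
    simp only [SimpleGraph.Walk.edges_cons, List.map_cons, List.sum_cons]
    have : depth G c ρ v x - depth G c ρ v y ≤ depthVar G c ρ v s(x, y) := le_abs_self _
    linarith

/-- The edge is shared out among the balls without being overcharged, even when it crosses the
boundaries of two balls. -/
lemma sum_depthVar_le {ρ : ℝ≥0} {D : Finset V}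
    (hsep : ∀ a ∈ D, ∀ b ∈ D, a ≠ b → ((ρ + ρ : ℝ≥0) : ℝ≥0∞) ≤ gdist G c a b)
    {e : Sym2 V} (he : e ∈ G.edgeSet) : ∑ v ∈ D, depthVar G c ρ v e ≤ c e := by
  induction e with
  | _ x y =>
    have hadj : G.Adj x y := he
    -- Disjointness of the balls is the case `x = y`, `d = 0` of `depth_add_depth_le`.
    have huniq : ∀ z, ∀ v ∈ D, ∀ w ∈ D, depth G c ρ v z ≠ 0 → depth G c ρ w z ≠ 0 → v = w := by
      intro z v hv w hw h₁ h₂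
      by_contra hne
      have := depth_add_depth_le (hsep v hv w hw hne) (d := 0) (gdist_self z).le h₁ h₂
      have h₁' := (depth_nonneg (G := G) (c := c) ρ v z).lt_of_ne' h₁
      have h₂' := depth_nonneg (G := G) (c := c) ρ w z
      simp only [NNReal.coe_zero] at this
      linarith
    exact sum_abs_sub_le_of_almost_disjoint D _ _ (c s(x, y)).2 (fun v _ => depth_nonneg _ _ _)
      (fun v _ => depth_nonneg _ _ _) (huniq x) (huniq y) (fun v _ => abs_depth_sub_le hadj)
      fun v hv w hw hne => depth_add_depth_le (hsep v hv w hw hne) (gdist_le_of_adj hadj)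

/-- Along a path in `S` from the centre `a` to a vertex outside its ball the depth falls from `ρ` to
0, so `S` carries variation at least `ρ` for each ball. Exchanging the sums over balls and edges,
each edge pays at most its cost. -/
lemma card_mul_le_cost [DecidableEq V] {S : Finset (Sym2 V)} (hS : (S : Set (Sym2 V)) ⊆ G.edgeSet)
    {D : Finset V} {ρ : ℝ≥0}
    (hsep : ∀ a ∈ D, ∀ b ∈ D, a ≠ b → ((ρ + ρ : ℝ≥0) : ℝ≥0∞) ≤ gdist G c a b)
    (hfar : ∀ a ∈ D, ∃ t, Connects S (a, t) ∧ (ρ : ℝ≥0∞) ≤ gdist G c a t) :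
    (D.card : ℝ) * ρ ≤ cost c S := by
  have h : ∀ a ∈ D, (ρ : ℝ) ≤ ∑ e ∈ S, depthVar G c ρ a e := by
    intro a ha
    obtain ⟨t, ht, hρ⟩ := hfar a ha
    obtain ⟨p, hp, hpS⟩ := ht.exists_path hS
    have := depth_sub_le_sum_depthVar (c := c) ρ a p
    rw [depth_self, depth_eq_zero hρ, sub_zero,
      ← List.sum_toFinset _ hp.isTrail.edges_nodup] at this
    exact this.trans (Finset.sum_le_sum_of_subset_of_nonneg (fun e he => hpS e (by simpa using he))
      fun e _ _ => depthVar_nonneg _ _ _)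
  calc (D.card : ℝ) * ρ = ∑ a ∈ D, (ρ : ℝ) := by simp
    _ ≤ ∑ a ∈ D, ∑ e ∈ S, depthVar G c ρ a e := Finset.sum_le_sum h
    _ = ∑ e ∈ S, ∑ a ∈ D, depthVar G c ρ a e := Finset.sum_comm
    _ ≤ ∑ e ∈ S, (c e : ℝ) := Finset.sum_le_sum fun e he => sum_depthVar_le hsep (hS he)
    _ = cost c S := by simp [cost]

end Packing

/-! ## Components met by a set of vertices -/

open Classical in
/-- The number of components of `F` that contain vertices of `D`. -/
noncomputable def numComponents (F : Finset (Sym2 V)) (D : Finset V) : ℕ :=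
  (D.image (SimpleGraph.fromEdgeSet (F : Set (Sym2 V))).connectedComponentMk).card

section Components

variable {F F' : Finset (Sym2 V)} {D : Finset V}

open Classical in
lemma image_component_image (h : F ⊆ F') :
    (D.image (SimpleGraph.fromEdgeSet (F : Set (Sym2 V))).connectedComponentMk).image
      (SimpleGraph.ConnectedComponent.map
        (SimpleGraph.Hom.ofLE (SimpleGraph.fromEdgeSet_mono (by exact_mod_cast h :
          (F : Set (Sym2 V)) ⊆ F')))) =
      D.image (SimpleGraph.fromEdgeSet (F' : Set (Sym2 V))).connectedComponentMk := by
  rw [Finset.image_image]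
  rfl

open Classical in
lemma numComponents_anti (h : F ⊆ F') (D : Finset V) : numComponents F' D ≤ numComponents F D := by
  rw [numComponents, ← image_component_image h]
  exact Finset.card_image_le

open Classical in
lemma numComponents_insert_le [DecidableEq V] (v : V) :
    numComponents F (insert v D) ≤ numComponents F D + 1 := by
  rw [numComponents, Finset.image_insert]
  exact Finset.card_insert_le _ _

open Classical in
-- The map from components of `F` to components of `F'` identifies those of `a` and `b`, so it is
-- not injective on the components that meet `D`.
lemma numComponents_lt (h : F ⊆ F') {a b : V} (ha : a ∈ D) (hb : b ∈ D)
    (hab : ¬ Connects F (a, b)) (hab' : Connects F' (a, b)) :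
    numComponents F' D < numComponents F D := by
  rw [numComponents, ← image_component_image h]
  refine lt_of_le_of_ne Finset.card_image_le fun heq => hab ?_
  rw [numComponents, Finset.card_image_iff] at heq
  refine SimpleGraph.ConnectedComponent.exact (heq (Finset.mem_coe.2 (Finset.mem_image_of_mem _ ha))
    (Finset.mem_coe.2 (Finset.mem_image_of_mem _ hb)) ?_)
  exact SimpleGraph.ConnectedComponent.sound hab'

end Components

/-! ## Single steps of the online algorithm -/

section OnStep

lemma ballsIntersect_comm {G : SimpleGraph V} {c : Sym2 V → ℝ≥0} {j : ℤ} {a b : V} :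
    BallsIntersect G c j a b ↔ BallsIntersect G c j b a := by
  rw [BallsIntersect, BallsIntersect, gdist_comm]

variable [DecidableEq V] {G : SimpleGraph V} {c : Sym2 V → ℝ≥0} {σ σ' : OnState V} {r : V × V}

lemma IsShortestPath.walkCost_le_gdist {F : Finset (Sym2 V)} {u v : V} {p : G.Walk u v}
    (hp : IsShortestPath (zeroOn c F) p) :
    (walkCost (zeroOn c F) p : ℝ≥0∞) ≤ gdist G c u v :=
  hp.walkCost_eq.trans_le (gdist_mono (zeroOn_le c F) u v)

lemma edges_toFinset_subset {u v : V} (p : G.Walk u v) :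
    (p.edges.toFinset : Set (Sym2 V)) ⊆ G.edgeSet := fun e he =>
  p.edges_subset_edgeSet (by simpa using he)

lemma OnStep.subset (h : OnStep G c σ r σ') : σ.F ⊆ σ'.F := by
  cases h <;> simp [Finset.union_assoc]

lemma OnStep.subset_edgeSet (h : OnStep G c σ r σ') (hF : (σ.F : Set (Sym2 V)) ⊆ G.edgeSet) :
    (σ'.F : Set (Sym2 V)) ⊆ G.edgeSet := by
  cases h <;> simp only [Finset.coe_union, Set.union_subset_iff] <;>
    simp only [hF, edges_toFinset_subset, and_self]

lemma OnStep.connects (h : OnStep G c σ r σ') : Connects σ'.F r := by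
  cases h with
  | free s t p => exact connects_of_walk p Finset.subset_union_right
  | ball s t p => exact connects_of_walk p Finset.subset_union_right
  | link s t p =>
    exact connects_of_walk p (Finset.subset_union_right.trans Finset.subset_union_left)

lemma zpow_floor_logb_le {p : ℝ} (hp : 0 < p) : (2 : ℝ) ^ ⌊Real.logb 2 p⌋ ≤ p := by
  have := Real.floor_logb_natCast (b := 2) (r := p) hp.le
  push_cast at this
  rw [this]
  exact_mod_cast Int.zpow_log_le_self (b := 2) one_lt_two hp

lemma lt_zpow_floor_logb {p : ℝ} (hp : 0 < p) : p < 2 * (2 : ℝ) ^ ⌊Real.logb 2 p⌋ := by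
  have := Real.floor_logb_natCast (b := 2) (r := p) hp.le
  push_cast at this
  rw [this, mul_comm, ← zpow_add_one₀ two_ne_zero]
  exact_mod_cast Int.lt_zpow_succ_log_self (b := 2) one_lt_two p

/-- The step from `σ` to `σ'` serves the request `r` on the scale `o`, where `none` means that
nothing is paid. -/
structure HasScale (G : SimpleGraph V) (c : Sym2 V → ℝ≥0) (σ : OnState V) (r : V × V)
    (σ' : OnState V) (o : Option ℤ) : Prop where
  cost_none : o = none → cost c (σ'.F \ σ.F) = 0
  cost_some : ∀ ℓ, o = some ℓ → cost c (σ'.F \ σ.F) ≤ 3 * 2 ^ ℓ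
  cost_le : (cost c (σ'.F \ σ.F) : ℝ≥0∞) ≤ 2 * gdist G c r.1 r.2
  le_gdist : ∀ ℓ, o = some ℓ → ((2 ^ ℓ : ℝ≥0) : ℝ≥0∞) ≤ gdist G c r.1 r.2
  count : ∀ j, 2 * (σ.D j).card + numComponents σ'.F (σ'.D j) + (if o = some j then 1 else 0) ≤
    2 * (σ'.D j).card + numComponents σ.F (σ.D j)
  center : ∀ j, ∀ a ∈ σ'.D j, a ∈ σ.D j ∨
    (a = r.1 ∨ a = r.2) ∧ ((2 ^ j : ℝ≥0) : ℝ≥0∞) ≤ gdist G c r.1 r.2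
  separated : ∀ j, (∀ a ∈ σ.D j, ∀ b ∈ σ.D j, a ≠ b → ¬ BallsIntersect G c j a b) →
    ∀ a ∈ σ'.D j, ∀ b ∈ σ'.D j, a ≠ b → ¬ BallsIntersect G c j a b

/-- Four radii make up `2 ^ ℓ`. This bounds the two links of a `link` step, and also the detour
through `a₁` and `a₂` that shows that the step merges two components. -/
lemma two_zpow_sub_two_add (ℓ : ℤ) :
    (2 : ℝ≥0) ^ (ℓ - 2) + (2 : ℝ≥0) ^ (ℓ - 2) + ((2 : ℝ≥0) ^ (ℓ - 2) + (2 : ℝ≥0) ^ (ℓ - 2)) =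
      2 ^ ℓ := by
  rw [zpow_sub₀ two_ne_zero]
  have : (2 : ℝ≥0) ^ (2 : ℤ) = 4 := by norm_num
  rw [this]
  ring_nf

lemma floor_logb_bounds {p : ℝ≥0} (h0 : p ≠ 0) :
    (2 : ℝ≥0) ^ ⌊Real.logb 2 (p : ℝ)⌋ ≤ p ∧ p ≤ 2 * (2 : ℝ≥0) ^ ⌊Real.logb 2 (p : ℝ)⌋ := by
  have hp : (0 : ℝ) < p := by exact_mod_cast pos_iff_ne_zero.2 h0
  constructor
  · rw [← NNReal.coe_le_coe]
    push_cast
    exact zpow_floor_logb_le hp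
  · rw [← NNReal.coe_le_coe]
    push_cast
    exact (lt_zpow_floor_logb hp).le

lemma cost_union_edges_sdiff_le (F : Finset (Sym2 V)) {u v : V} {p : G.Walk u v} (hp : p.IsPath) :
    cost c ((F ∪ p.edges.toFinset) \ F) ≤ walkCost (zeroOn c F) p := by
  rw [Finset.union_sdiff_left]
  exact cost_edges_sdiff_le hp F

/-- The field `count` says that the potential "twice the number of balls minus the number of
components of `F` meeting their centres" rises by at least one in every step on scale `j`. A new
ball adds two and creates at most one component; a link adds no ball and destroys a component. -/
lemma OnStep.exists_hasScale (h : OnStep G c σ r σ') (hF : (σ.F : Set (Sym2 V)) ⊆ G.edgeSet) :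
    ∃ o, HasScale G c σ r σ' o := by
  cases h with
  | free s t p hp h0 =>
    have hz : cost c ((σ.F ∪ p.edges.toFinset) \ σ.F) = 0 :=
      le_antisymm ((cost_union_edges_sdiff_le _ hp.1).trans h0.le) zero_le
    refine ⟨none, fun _ => hz, by simp, by simp [hz], by simp, fun j => ?_, fun j a ha => Or.inl ha,
      fun j h => h⟩
    have := numComponents_anti (D := σ.D j) (Finset.subset_union_left (s₁ := σ.F)
      (s₂ := p.edges.toFinset))
    simpa using this
  | ball s t p hp h0 ℓ hℓ v hv hD =>
    obtain ⟨hp₁, hp₂⟩ := floor_logb_bounds h0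
    rw [← hℓ] at hp₁ hp₂
    have hcost := cost_union_edges_sdiff_le (c := c) σ.F hp.1
    have hdist := hp.walkCost_le_gdist
    have hsub := Finset.subset_union_left (s₁ := σ.F) (s₂ := p.edges.toFinset)
    have hle : ((2 ^ ℓ : ℝ≥0) : ℝ≥0∞) ≤ gdist G c s t :=
      le_trans (by exact_mod_cast hp₁) hdist
    have hvD : v ∉ σ.D ℓ := fun hmem => hD v hmem (by
      rw [BallsIntersect, gdist_self]
      exact_mod_cast (by positivity : (0 : ℝ≥0) < 2 ^ (ℓ - 2) + 2 ^ (ℓ - 2)))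
    refine ⟨some ℓ, by simp, ?_, ?_, ?_, fun j => ?_, fun j a ha => ?_, fun j h => ?_⟩
    · rintro _ ⟨⟩
      exact (hcost.trans hp₂).trans (by gcongr; norm_num)
    · refine le_trans (by exact_mod_cast hcost) (hdist.trans ?_)
      exact le_mul_of_one_le_left zero_le (by norm_num)
    · rintro _ ⟨⟩
      exact hle
    · by_cases hj : j = ℓ
      · subst hj
        have h₁ := numComponents_anti hsub (σ.D j)
        have h₂ := numComponents_insert_le (F := σ.F ∪ p.edges.toFinset) (D := σ.D j) v
        simp only [Function.update_self, Finset.card_insert_of_notMem hvD, if_true]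
        omega
      · have h₁ := numComponents_anti hsub (σ.D j)
        simp only [Function.update_of_ne hj, Option.some.injEq, Ne.symm hj, if_false]
        omega
    · by_cases hj : j = ℓ
      · subst hj
        simp only [Function.update_self, Finset.mem_insert] at ha
        rcases ha with rfl | ha
        · exact Or.inr ⟨hv, hle⟩
        · exact Or.inl ha
      · simp only [Function.update_of_ne hj] at ha
        exact Or.inl ha
    · by_cases hj : j = ℓ
      · subst hj
        simp only [Function.update_self, Finset.mem_insert]
        rintro a (rfl | ha) b (rfl | hb) hab
        · exact absurd rfl hab
        · exact fun h => hD b hb (ballsIntersect_comm.1 h)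
        · exact hD a ha
        · exact h a ha b hb hab
      · simpa only [Function.update_of_ne hj] using h
  | link s t p hp h0 ℓ hℓ a₁ a₂ ha₁ ha₂ hs ht q₁ q₂ hq₁ hq₂ =>
    obtain ⟨hp₁, hp₂⟩ := floor_logb_bounds h0
    rw [← hℓ] at hp₁ hp₂
    have hdist := hp.walkCost_le_gdist
    have hsub : σ.F ⊆ σ.F ∪ p.edges.toFinset ∪ (q₁.edges.toFinset ∪ q₂.edges.toFinset) :=
      Finset.subset_union_left.trans Finset.subset_union_left
    have hpow := two_zpow_sub_two_add ℓ
    have hlink : ∀ {a v : V} {q : G.Walk a v}, BallsIntersect G c ℓ a v →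
        IsShortestPath (zeroOn c (σ.F ∪ p.edges.toFinset)) q →
        walkCost (zeroOn c (σ.F ∪ p.edges.toFinset)) q ≤ 2 ^ (ℓ - 2) + 2 ^ (ℓ - 2) := by
      intro a v q h hq
      exact_mod_cast hq.walkCost_le_gdist.trans h.le
    have hcost : cost c ((σ.F ∪ p.edges.toFinset ∪ (q₁.edges.toFinset ∪ q₂.edges.toFinset)) \ σ.F)
        ≤ walkCost (zeroOn c σ.F) p + 2 ^ ℓ := by
      have hsplit : (σ.F ∪ p.edges.toFinset ∪ (q₁.edges.toFinset ∪ q₂.edges.toFinset)) \ σ.F ⊆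
          p.edges.toFinset \ σ.F ∪ (q₁.edges.toFinset \ (σ.F ∪ p.edges.toFinset) ∪
            q₂.edges.toFinset \ (σ.F ∪ p.edges.toFinset)) := by
        intro e
        simp only [Finset.mem_sdiff, Finset.mem_union]
        tauto
      refine (cost_mono hsplit).trans ((cost_union_le _ _).trans ?_)
      rw [← hpow]
      refine add_le_add (cost_edges_sdiff_le hp.1 _) ((cost_union_le _ _).trans ?_)
      exact add_le_add ((cost_edges_sdiff_le hq₁.1 _).trans (hlink hs hq₁))
        ((cost_edges_sdiff_le hq₂.1 _).trans (hlink ht hq₂))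
    have hle : ((2 ^ ℓ : ℝ≥0) : ℝ≥0∞) ≤ gdist G c s t :=
      le_trans (by exact_mod_cast hp₁) hdist
    have hnew : Connects (σ.F ∪ p.edges.toFinset ∪ (q₁.edges.toFinset ∪ q₂.edges.toFinset))
        (a₁, a₂) := by
      have h₁ := connects_of_walk q₁ (S := σ.F ∪ p.edges.toFinset ∪
        (q₁.edges.toFinset ∪ q₂.edges.toFinset)) (by intro e; simp; tauto)
      have h₂ := connects_of_walk q₂ (S := σ.F ∪ p.edges.toFinset ∪
        (q₁.edges.toFinset ∪ q₂.edges.toFinset)) (by intro e; simp; tauto)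
      have h₃ := connects_of_walk p (S := σ.F ∪ p.edges.toFinset ∪
        (q₁.edges.toFinset ∪ q₂.edges.toFinset)) (by intro e; simp; tauto)
      exact (h₁.trans h₃).trans h₂.symm
    -- If the centres were already connected, going from `s` to `a₁`, freely to `a₂`, and on to `t`
    -- would cost less than `2 ^ ℓ`, hence less than the shortest path `p`.
    have hold : ¬ Connects σ.F (a₁, a₂) := by
      intro hcon
      have h₀ := hcon.gdist_zeroOn (c := c) hF subset_rfl
      have hm := gdist_mono (G := G) (zeroOn_le c σ.F)
      have h₁ : gdist G (zeroOn c σ.F) s t < ((2 ^ ℓ : ℝ≥0) : ℝ≥0∞) := by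
        calc gdist G (zeroOn c σ.F) s t
            ≤ gdist G (zeroOn c σ.F) s a₁ + gdist G (zeroOn c σ.F) a₁ t := gdist_triangle _ _ _
          _ ≤ gdist G (zeroOn c σ.F) s a₁ + (gdist G (zeroOn c σ.F) a₁ a₂ +
              gdist G (zeroOn c σ.F) a₂ t) := by gcongr; exact gdist_triangle _ _ _
          _ ≤ gdist G c a₁ s + gdist G c a₂ t := by
              rw [h₀, zero_add, gdist_comm s a₁]
              exact add_le_add (hm _ _) (hm _ _)
          _ < _ := ENNReal.add_lt_add hs ht
          _ = _ := by rw [← ENNReal.coe_add, hpow]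
      rw [← hp.walkCost_eq] at h₁
      exact absurd hp₁ (not_le.2 (by exact_mod_cast h₁))
    refine ⟨some ℓ, by simp, ?_, ?_, ?_, fun j => ?_, fun j a ha => Or.inl ha, fun j h => h⟩
    · rintro _ ⟨⟩
      refine hcost.trans ((add_le_add_left hp₂ _).trans (le_of_eq ?_))
      ring
    · have : cost c ((σ.F ∪ p.edges.toFinset ∪ (q₁.edges.toFinset ∪ q₂.edges.toFinset)) \ σ.F)
          ≤ 2 * walkCost (zeroOn c σ.F) p := by
        rw [two_mul]
        exact hcost.trans (by gcongr)
      refine le_trans (by exact_mod_cast this : _ ≤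
        ((2 * walkCost (zeroOn c σ.F) p : ℝ≥0) : ℝ≥0∞)) ?_
      rw [ENNReal.coe_mul]
      exact mul_le_mul' le_rfl hdist
    · rintro _ ⟨⟩
      exact hle
    · have h₁ := numComponents_anti hsub (σ.D j)
      by_cases hj : ℓ = j
      · subst hj
        have h₂ := numComponents_lt hsub ha₁ ha₂ hold hnew
        simp only [if_true]
        omega
      · simp only [Option.some.injEq, hj, if_false]
        omega

/-- This per-request bound serves requests matched with satisfied predictions, and limits how far
one step can overshoot the doubled budget. -/
lemma OnStep.cost_le (h : OnStep G c σ r σ') (hF : (σ.F : Set (Sym2 V)) ⊆ G.edgeSet) :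
    (cost c (σ'.F \ σ.F) : ℝ≥0∞) ≤ 2 * gdist G c r.1 r.2 :=
  let ⟨_, ho⟩ := h.exists_hasScale hF
  ho.cost_le

lemma exists_onStep [Fintype V] (G : SimpleGraph V) (c : Sym2 V → ℝ≥0) (σ : OnState V)
    (h : G.Reachable r.1 r.2) : ∃ σ', OnStep G c σ r σ' := by
  obtain ⟨s, t⟩ := r
  obtain ⟨p, hp⟩ := exists_isShortestPath (zeroOn c σ.F) h
  by_cases h0 : walkCost (zeroOn c σ.F) p = 0
  · exact ⟨_, .free σ s t p hp h0⟩
  by_cases hs : ∃ a ∈ σ.D ⌊Real.logb 2 (walkCost (zeroOn c σ.F) p : ℝ)⌋,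
      BallsIntersect G c ⌊Real.logb 2 (walkCost (zeroOn c σ.F) p : ℝ)⌋ a s
  · by_cases ht : ∃ a ∈ σ.D ⌊Real.logb 2 (walkCost (zeroOn c σ.F) p : ℝ)⌋,
        BallsIntersect G c ⌊Real.logb 2 (walkCost (zeroOn c σ.F) p : ℝ)⌋ a t
    · obtain ⟨a₁, ha₁, h₁⟩ := hs
      obtain ⟨a₂, ha₂, h₂⟩ := ht
      obtain ⟨q₁, hq₁⟩ := exists_isShortestPath (zeroOn c (σ.F ∪ p.edges.toFinset))
        (reachable_of_gdist_ne_top (lt_top_of_lt h₁).ne)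
      obtain ⟨q₂, hq₂⟩ := exists_isShortestPath (zeroOn c (σ.F ∪ p.edges.toFinset))
        (reachable_of_gdist_ne_top (lt_top_of_lt h₂).ne)
      exact ⟨_, .link σ s t p hp h0 _ rfl a₁ a₂ ha₁ ha₂ h₁ h₂ q₁ q₂ hq₁ hq₂⟩
    · push Not at ht
      exact ⟨_, .ball σ s t p hp h0 _ rfl t (Or.inr rfl) ht⟩
  · push Not at hs
    exact ⟨_, .ball σ s t p hp h0 _ rfl s (Or.inl rfl) hs⟩

end OnStep

/-! ## Runs of the online algorithm -/

section OnRun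

variable [DecidableEq V] {G : SimpleGraph V} {c : Sym2 V → ℝ≥0} {r : ℕ → V × V} {a b : ℕ}
  {on : ℕ → OnState V}

lemma onRun_subset_edgeSet (h0 : on a = OnState.init V)
    (hstep : ∀ j, a ≤ j → j < b → OnStep G c (on j) (r j) (on (j + 1))) {i : ℕ} (hai : a ≤ i)
    (hib : i ≤ b) : ((on i).F : Set (Sym2 V)) ⊆ G.edgeSet := by
  induction i, hai using Nat.le_induction with
  | base => simp [h0, OnState.init]
  | succ i hai ih => exact (hstep i hai hib).subset_edgeSet (ih (by omega))

lemma onRun_center (h0 : on a = OnState.init V) {o : ℕ → Option ℤ}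
    (ho : ∀ j, a ≤ j → j < b → HasScale G c (on j) (r j) (on (j + 1)) (o j))
    {S : Finset (Sym2 V)} (hr : ∀ j, a ≤ j → j < b → Connects S (r j)) (ℓ : ℤ) {i : ℕ}
    (hai : a ≤ i) (hib : i ≤ b) :
    ∀ v ∈ (on i).D ℓ, ∃ t, Connects S (v, t) ∧ ((2 ^ ℓ : ℝ≥0) : ℝ≥0∞) ≤ gdist G c v t := by
  induction i, hai using Nat.le_induction with
  | base => simp [h0, OnState.init]
  | succ i hai ih =>
    intro v hv
    rcases (ho i hai hib).center ℓ v hv with hv | ⟨rfl | rfl, hle⟩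
    · exact ih (by omega) v hv
    · exact ⟨_, hr i hai hib, hle⟩
    · exact ⟨_, (hr i hai hib).symm, by rwa [gdist_comm]⟩

lemma onRun_separated (h0 : on a = OnState.init V) {o : ℕ → Option ℤ}
    (ho : ∀ j, a ≤ j → j < b → HasScale G c (on j) (r j) (on (j + 1)) (o j)) (ℓ : ℤ) {i : ℕ}
    (hai : a ≤ i) (hib : i ≤ b) :
    ∀ v ∈ (on i).D ℓ, ∀ w ∈ (on i).D ℓ, v ≠ w → ¬ BallsIntersect G c ℓ v w := by
  induction i, hai using Nat.le_induction with
  | base => simp [h0, OnState.init]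
  | succ i hai ih => exact (ho i hai hib).separated ℓ (ih (by omega))

/-- The potential of `HasScale.count` starts at zero, so it bounds the number of steps on the scale.
-/
lemma onRun_card_scale (h0 : on a = OnState.init V) {o : ℕ → Option ℤ}
    (ho : ∀ j, a ≤ j → j < b → HasScale G c (on j) (r j) (on (j + 1)) (o j)) (ℓ : ℤ) {i : ℕ}
    (hai : a ≤ i) (hib : i ≤ b) :
    ((Finset.Ico a i).filter (o · = some ℓ)).card + numComponents (on i).F ((on i).D ℓ) ≤
      2 * ((on i).D ℓ).card := by
  induction i, hai using Nat.le_induction with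
  | base => simp [h0, OnState.init, numComponents]
  | succ i hai ih =>
    have h₁ := ih (by omega)
    have h₂ := (ho i hai hib).count ℓ
    rw [Finset.Ico_add_one_right_eq_Icc, ← Finset.Ico_insert_right hai, Finset.filter_insert]
    split_ifs at h₂ ⊢
    · rw [Finset.card_insert_of_notMem (by simp)]
      omega
    · omega

lemma onRun_sum_cost_le (h0 : on a = OnState.init V)
    (hstep : ∀ j, a ≤ j → j < b → OnStep G c (on j) (r j) (on (j + 1)))
    {S : Finset (Sym2 V)} (hS : (S : Set (Sym2 V)) ⊆ G.edgeSet)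
    (hr : ∀ j, a ≤ j → j < b → Connects S (r j)) {P : Finset ℕ} (hP : P ⊆ Finset.Ico a b) :
    ∑ j ∈ P, (cost c ((on (j + 1)).F \ (on j).F) : ℝ) ≤
      100 * Real.log (P.card + 2) * cost c S := by
  rcases lt_or_ge b a with hba | hab
  · rw [Finset.Ico_eq_empty (by omega), Finset.subset_empty] at hP
    subst hP
    simp only [Finset.sum_empty]
    have := Real.log_nonneg one_le_two
    simp only [Finset.card_empty, Nat.cast_zero, zero_add]
    positivity
  have hex : ∀ j, ∃ o, a ≤ j → j < b → HasScale G c (on j) (r j) (on (j + 1)) o := by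
    intro j
    by_cases hj : a ≤ j ∧ j < b
    · obtain ⟨o, ho⟩ := (hstep j hj.1 hj.2).exists_hasScale
        (onRun_subset_edgeSet h0 hstep hj.1 hj.2.le)
      exact ⟨o, fun _ _ => ho⟩
    · exact ⟨none, fun h h' => absurd ⟨h, h'⟩ hj⟩
  choose o ho using hex
  have hballs : ∀ ℓ : ℤ, (((on b).D ℓ).card : ℝ) * 2 ^ (ℓ - 2) ≤ cost c S := by
    intro ℓ
    have h := card_mul_le_cost (c := c) hS (D := (on b).D ℓ) (ρ := 2 ^ (ℓ - 2))
      (fun v hv w hw hvw => not_lt.1 (onRun_separated h0 ho ℓ hab le_rfl v hv w hw hvw))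
      fun v hv => by
        obtain ⟨t, ht, hle⟩ := onRun_center h0 ho hr ℓ hab le_rfl v hv
        refine ⟨t, ht, le_trans ?_ hle⟩
        exact_mod_cast zpow_le_zpow_right₀ (one_le_two : (1 : ℝ≥0) ≤ 2) (by omega : ℓ - 2 ≤ ℓ)
    push_cast at h
    exact h
  have hcard : ∀ ℓ : ℤ, ((P.filter (o · = some ℓ)).card : ℝ) * 2 ^ ℓ ≤ 8 * cost c S := by
    intro ℓ
    have h₁ : (P.filter (o · = some ℓ)).card ≤ 2 * ((on b).D ℓ).card :=
      (Finset.card_le_card (Finset.filter_subset_filter _ hP)).trans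
        (le_trans (Nat.le_add_right _ _) (onRun_card_scale h0 ho ℓ hab le_rfl))
    have h₂ : ((P.filter (o · = some ℓ)).card : ℝ) ≤ 2 * ((on b).D ℓ).card := by exact_mod_cast h₁
    have h₃ : (2 : ℝ) ^ ℓ = 4 * 2 ^ (ℓ - 2) := by
      rw [zpow_sub₀ two_ne_zero]
      norm_num
      ring
    calc _ ≤ 2 * (((on b).D ℓ).card : ℝ) * 2 ^ ℓ := by gcongr
      _ = 8 * ((((on b).D ℓ).card : ℝ) * 2 ^ (ℓ - 2)) := by rw [h₃]; ring
      _ ≤ _ := by gcongr; exact hballs ℓ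
  have hmem : ∀ j ∈ P, a ≤ j ∧ j < b := fun j hj => Finset.mem_Ico.1 (hP hj)
  -- Steps without a scale cost nothing and are filtered out, so the default level 0 is never used.
  have hlvl : ∀ j ∈ P.filter (o · ≠ none), o j = some ((o j).getD 0) := by
    intro j hj
    obtain ⟨ℓ, hℓ⟩ := Option.ne_none_iff_exists'.1 (Finset.mem_filter.1 hj).2
    simp [hℓ]
  have hmain := sum_le_log_of_card_level_le (P.filter (o · ≠ none))
    (fun j => (cost c ((on (j + 1)).F \ (on j).F) : ℝ)) (fun j => (o j).getD 0)
    (X := cost c S) (by positivity)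
    (fun j hj => by
      obtain ⟨h₁, h₂⟩ := hmem j (Finset.mem_filter.1 hj).1
      exact_mod_cast (ho j h₁ h₂).cost_some _ (hlvl j hj))
    (fun j hj => by
      obtain ⟨h₁, h₂⟩ := hmem j (Finset.mem_filter.1 hj).1
      have := ((ho j h₁ h₂).le_gdist _ (hlvl j hj)).trans ((hr j h₁ h₂).gdist_le hS)
      exact_mod_cast this)
    (fun ℓ => by
      refine le_trans ?_ (hcard ℓ)
      gcongr
      intro j hj
      rw [Finset.mem_filter] at hj ⊢
      exact ⟨(Finset.mem_filter.1 hj.1).1, by rw [hlvl j hj.1, hj.2]⟩)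
  rw [← Finset.sum_filter_of_ne (p := (o · ≠ none))]
  · refine hmain.trans ?_
    gcongr
    exact Finset.filter_subset _ _
  · intro j hj hne hnone
    obtain ⟨h₁, h₂⟩ := hmem j hj
    exact hne (by simp [(ho j h₁ h₂).cost_none hnone])

end OnRun

/-! ## The subroutine `Partial` -/

section Partial

variable {G : SimpleGraph V} {c : Sym2 V → ℝ≥0} {γ : ℝ≥0}
  {PC : List (V × V) → (V × V → ℝ≥0) → Finset (Sym2 V)} {Rh : List (V × V)} {u : ℕ}
  {S T : Finset (Sym2 V)}

lemma prizeCost_const (R : List (V × V)) (x : ℝ≥0) (S : Finset (Sym2 V)) :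
    prizeCost c R (fun _ => x) S = cost c S + (unsatisfied R S).length * x := by
  simp [prizeCost]

lemma IsPrizeCollectingApprox.cost_add_le (hPC : IsPrizeCollectingApprox G c γ PC)
    (hS : (S : Set (Sym2 V)) ⊆ G.edgeSet) (hu : (unsatisfied Rh S).length ≤ u) (x : ℝ≥0) :
    (cost c (PC Rh fun _ => x) : ℝ) + (unsatisfied Rh (PC Rh fun _ => x)).length * x ≤
      γ * (cost c S + u * x) := by
  have h := hPC.approx Rh (fun _ => x) S hS
  rw [prizeCost_const, prizeCost_const] at h
  have h' : (unsatisfied Rh S).length * x ≤ u * x := by gcongr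
  exact_mod_cast h.trans (mul_le_mul' le_rfl (add_le_add_right h' _))

lemma unsatisfied_length_le (R : List (V × V)) (S : Finset (Sym2 V)) :
    (unsatisfied R S).length ≤ R.length := List.length_filter_le _ _

lemma IsPartial.subset (hPC : IsPrizeCollectingApprox G c γ PC) (hT : IsPartial γ PC Rh u T) :
    (T : Set (Sym2 V)) ⊆ G.edgeSet := by
  rcases hT with ⟨_, rfl⟩ | ⟨_, i, _, ⟨_, rfl⟩ | ⟨_, rfl⟩⟩
  · simp
  · exact hPC.subset _ _
  · exact hPC.subset _ _

/-- The factor 2 arises when the cheaper solution is returned: `u₁ ≤ u₁ + u₂ ≤ 2γu`. -/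
lemma IsPartial.unsatisfied_le (hT : IsPartial γ PC Rh u T) :
    ((unsatisfied Rh T).length : ℝ) ≤ 2 * γ * u := by
  have hpos : (0 : ℝ) ≤ γ * u := by positivity
  rcases hT with ⟨h, rfl⟩ | ⟨_, i, hi, ⟨h, rfl⟩ | ⟨_, rfl⟩⟩
  · have h₁ : ((unsatisfied Rh ∅).length : ℝ) ≤ Rh.length := by
      exact_mod_cast unsatisfied_length_le Rh ∅
    have h₂ : (Rh.length : ℝ) ≤ γ * u := by exact_mod_cast h
    linarith
  · have h' : (((unsatisfied Rh (PC Rh fun _ => (2 : ℝ≥0) ^ (i - 1))).length : ℝ) +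
        (unsatisfied Rh (PC Rh fun _ => (2 : ℝ≥0) ^ i)).length) / 2 ≤ γ * u := by
      dsimp only at h
      exact_mod_cast h
    have : (0 : ℝ) ≤ (unsatisfied Rh (PC Rh fun _ => (2 : ℝ≥0) ^ i)).length := by positivity
    linarith
  · have h' : ((unsatisfied Rh (PC Rh fun _ => (2 : ℝ≥0) ^ i)).length : ℝ) ≤ γ * u := by
      exact_mod_cast hi.1
    linarith

/-- Compare both outputs of `PC` with `S`, and let `x = 2 ^ (i - 1)`. For penalty `x` this gives
`c(S₁) + x(u₁ - γu) ≤ γ c(S)`, where `u₁ > γu` because `i` is minimal. For penalty `2x` it gives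
`c(S₂) ≤ γ c(S) + 2x(γu - u₂)`. If `S₂` is returned, then `γu - u₂ < u₁ - γu`, so the last term is
at most `2γ c(S)`. -/
lemma IsPartial.cost_le (hPC : IsPrizeCollectingApprox G c γ PC) (hT : IsPartial γ PC Rh u T)
    (hS : (S : Set (Sym2 V)) ⊆ G.edgeSet) (hu : (unsatisfied Rh S).length ≤ u) :
    (cost c T : ℝ) ≤ 3 * γ * cost c S := by
  have hpos : (0 : ℝ) ≤ γ * cost c S := by positivity
  rcases hT with ⟨h, rfl⟩ | ⟨_, i, hi, hT⟩
  · simp only [cost, Finset.sum_empty, NNReal.coe_zero] at *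
    linarith
  have h₁ := hPC.cost_add_le hS hu (2 ^ (i - 1))
  have h₂ := hPC.cost_add_le hS hu (2 ^ i)
  have hu₁ : (γ * u : ℝ) < (unsatisfied Rh (PC Rh fun _ => (2 : ℝ≥0) ^ (i - 1))).length := by
    have : ¬ (i - 1 ∈ {k : ℤ | ((unsatisfied Rh (PC Rh fun _ => (2 : ℝ≥0) ^ k)).length : ℝ≥0) ≤
        γ * u}) := fun h => by linarith [hi.2 h]
    rw [Set.mem_ofPred_eq, not_le] at this
    exact_mod_cast this
  set u₁ : ℝ := ((unsatisfied Rh (PC Rh fun _ => (2 : ℝ≥0) ^ (i - 1))).length : ℝ) with hu₁'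
  set u₂ : ℝ := ((unsatisfied Rh (PC Rh fun _ => (2 : ℝ≥0) ^ i)).length : ℝ) with hu₂'
  have hzpos : (0 : ℝ) < 2 ^ (i - 1) := by positivity
  have hz : (2 : ℝ) ^ i = 2 * 2 ^ (i - 1) := by rw [← zpow_one_add₀ two_ne_zero]; congr 1; ring
  push_cast at h₁ h₂
  rw [hz] at h₂
  have h₃ : (2 : ℝ) ^ (i - 1) * (u₁ - γ * u) + cost c (PC Rh fun _ => (2 : ℝ≥0) ^ (i - 1)) ≤
      γ * cost c S := by linarith
  have h₄ : (0 : ℝ) ≤ 2 ^ (i - 1) * (u₁ - γ * u) := mul_nonneg hzpos.le (by linarith)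
  have h₅ : (0 : ℝ) ≤ cost c (PC Rh fun _ => (2 : ℝ≥0) ^ (i - 1)) := NNReal.coe_nonneg _
  rcases hT with ⟨h, rfl⟩ | ⟨h, rfl⟩
  · linarith
  · have h' : (γ * u : ℝ) < (u₁ + u₂) / 2 := by
      dsimp only at h
      rw [← NNReal.coe_lt_coe] at h
      push_cast at h
      exact h
    have h₆ : (2 : ℝ) ^ (i - 1) * (γ * u - u₂) ≤ 2 ^ (i - 1) * (u₁ - γ * u) :=
      mul_le_mul_of_nonneg_left (by linarith) hzpos.le
    linarith

lemma exists_pos_le_gdist {Rh : List (V × V)}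
    (h : ∀ q ∈ Rh, 0 < gdist G c q.1 q.2) :
    ∃ δ : ℝ≥0, 0 < δ ∧ ∀ q ∈ Rh, (δ : ℝ≥0∞) ≤ gdist G c q.1 q.2 := by
  induction Rh with
  | nil => exact ⟨1, one_pos, by simp⟩
  | cons q Rh ih =>
    obtain ⟨δ, hδ, hle⟩ := ih fun q hq => h q (List.mem_cons_of_mem _ hq)
    obtain ⟨ε, hε, hlt⟩ := ENNReal.lt_iff_exists_nnreal_btwn.1 (h q List.mem_cons_self)
    refine ⟨min δ ε, lt_min hδ (by exact_mod_cast hε), fun q' hq' => ?_⟩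
    rcases List.mem_cons.1 hq' with rfl | hq'
    · exact le_trans (by exact_mod_cast min_le_right δ ε) hlt.le
    · exact le_trans (by exact_mod_cast min_le_left δ ε) (hle q' hq')

lemma unsatisfied_eq_nil (h : ∀ q ∈ Rh, Connects S q) : unsatisfied Rh S = [] := by
  simpa [unsatisfied] using h

lemma unsatisfied_eq_self (h : ∀ q ∈ Rh, ¬ Connects S q) : unsatisfied Rh S = Rh := by
  simpa [unsatisfied] using h

/-- What needs proof is that a least exponent exists. For tiny penalties, buying nothing is so cheap
that `PC` cannot afford to connect any pair, the pairs having positive distance. For huge penalties,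
buying all edges is cheaper than missing one pair, the pairs being connected in `G`. -/
lemma exists_isPartial [Fintype V] [DecidableEq V] (hPC : IsPrizeCollectingApprox G c γ PC)
    (hRh : ∀ q ∈ Rh, G.Reachable q.1 q.2 ∧ 0 < gdist G c q.1 q.2) (u : ℕ) :
    ∃ T, IsPartial γ PC Rh u T := by
  rcases le_or_gt (Rh.length : ℝ≥0) (γ * u) with h | h
  · exact ⟨∅, Or.inl ⟨h, rfl⟩⟩
  obtain ⟨δ, hδ, hle⟩ := exists_pos_le_gdist fun q hq => (hRh q hq).2
  have hlow : ∃ b : ℤ, ∀ k : ℤ,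
      ((unsatisfied Rh (PC Rh fun _ => (2 : ℝ≥0) ^ k)).length : ℝ≥0) ≤ γ * u → b ≤ k := by
    -- With this `n`, a penalty below `2 ^ (-n)` forces the cost of `PC` below the least distance
    -- `δ` of a predicted pair.
    obtain ⟨n, hn⟩ := pow_unbounded_of_one_lt (γ * Rh.length / δ : ℝ) one_lt_two
    refine ⟨-n, fun k hk => ?_⟩
    by_contra hkn
    refine absurd (hk.trans_lt h) (not_lt.2 ?_)
    rw [unsatisfied_eq_self]
    intro q hq hcon
    have h₁ : (δ : ℝ) ≤ cost c (PC Rh fun _ => (2 : ℝ≥0) ^ k) := by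
      exact_mod_cast (hle q hq).trans (Connects.gdist_le (c := c) (hPC.subset _ _) hcon)
    have h₂ := hPC.cost_add_le (S := ∅) (by simp) (unsatisfied_length_le Rh ∅) (2 ^ k)
    have h₃ : (0 : ℝ) ≤ (unsatisfied Rh (PC Rh fun _ => (2 : ℝ≥0) ^ k)).length *
        ((2 ^ k : ℝ≥0) : ℝ) := by positivity
    simp only [cost, Finset.sum_empty, NNReal.coe_zero, zero_add] at h₁ h₂
    have hδ' : (0 : ℝ) < δ := hδ
    rw [div_lt_iff₀ hδ'] at hn
    have h₄ : (2 : ℝ) ^ k * 2 ^ n ≤ 1 := by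
      rw [← zpow_natCast, ← zpow_add₀ two_ne_zero]
      exact zpow_le_one_of_nonpos₀ one_le_two (by omega)
    have h₅ : (δ : ℝ) ≤ (γ * Rh.length) * 2 ^ k := by
      push_cast at h₁ h₂ h₃
      linarith
    have h₆ : (2 : ℝ) ^ k * (γ * Rh.length) < 2 ^ k * (2 ^ n * δ) :=
      mul_lt_mul_of_pos_left hn (by positivity)
    have h₇ : (2 : ℝ) ^ k * 2 ^ n * δ ≤ 1 * δ := mul_le_mul_of_nonneg_right h₄ hδ'.le
    linarith
  have hex : ∃ k : ℤ, ((unsatisfied Rh (PC Rh fun _ => (2 : ℝ≥0) ^ k)).length : ℝ≥0) ≤ γ * u := by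
    have hfin : G.edgeSet.Finite := Set.toFinite _
    have hun : unsatisfied Rh hfin.toFinset = [] := unsatisfied_eq_nil fun q hq => by
      obtain ⟨p⟩ := (hRh q hq).1
      exact connects_of_walk p fun e he =>
        hfin.mem_toFinset.2 (p.edges_subset_edgeSet (by simpa using he))
    obtain ⟨n, hn⟩ := pow_unbounded_of_one_lt (γ * cost c hfin.toFinset : ℝ) one_lt_two
    have h₁ := hPC.cost_add_le (S := hfin.toFinset) (Rh := Rh) (u := 0) (by simp) (by simp [hun])
      (2 ^ (n : ℤ))
    have h₂ : (0 : ℝ) ≤ cost c (PC Rh fun _ => (2 : ℝ≥0) ^ (n : ℤ)) := NNReal.coe_nonneg _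
    refine ⟨n, le_of_eq_of_le ?_ zero_le⟩
    rw [Nat.cast_eq_zero]
    by_contra hne
    have h₃ : (1 : ℝ) ≤ (unsatisfied Rh (PC Rh fun _ => (2 : ℝ≥0) ^ (n : ℤ))).length := by
      exact_mod_cast Nat.one_le_iff_ne_zero.2 hne
    have h₄ : (2 : ℝ) ^ n ≤
        (unsatisfied Rh (PC Rh fun _ => (2 : ℝ≥0) ^ (n : ℤ))).length * 2 ^ n :=
      le_mul_of_one_le_left (by positivity) h₃
    push_cast [zpow_natCast] at h₁ h₂ h₃ h₄ hn
    linarith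
  obtain ⟨b, hb⟩ := hlow
  obtain ⟨i, hi, hmin⟩ := Int.exists_least_of_bdd ⟨b, hb⟩ hex
  have hleast : IsLeast {k : ℤ |
      ((unsatisfied Rh (PC Rh fun _ => (2 : ℝ≥0) ^ k)).length : ℝ≥0) ≤ γ * u} i := ⟨hi, hmin⟩
  rcases le_or_gt ((((unsatisfied Rh (PC Rh fun _ => (2 : ℝ≥0) ^ (i - 1))).length : ℝ≥0) +
    (unsatisfied Rh (PC Rh fun _ => (2 : ℝ≥0) ^ i)).length) / 2) (γ * u) with h' | h'
  · exact ⟨_, Or.inr ⟨h, i, hleast, Or.inl ⟨h', rfl⟩⟩⟩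
  · exact ⟨_, Or.inr ⟨h, i, hleast, Or.inr ⟨h', rfl⟩⟩⟩

end Partial

/-! ## Steps of the framework -/

section Framework

variable {G : SimpleGraph V} {c : Sym2 V → ℝ≥0} {γ : ℝ≥0}
  {PC : List (V × V) → (V × V → ℝ≥0) → Finset (Sym2 V)} {Rh : List (V × V)}
  {σ σ' : State V} {r : V × V}

/-- The bookkeeping of the framework. -/
structure State.Valid (G : SimpleGraph V) (c : Sym2 V → ℝ≥0) (γ : ℝ≥0) (σ : State V) : Prop where
  subset_edgeSet : (σ.S : Set (Sym2 V)) ⊆ G.edgeSet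
  free_subset : σ.S₀ ⊆ σ.S
  on_subset : σ.on.F ⊆ σ.S
  cost_le : cost c σ.S ≤ σ.B + 6 * γ * σ.Bh
  budget : σ.B ≤ 2 * σ.Bh

lemma State.valid_init : (State.init V).Valid G c γ := by
  constructor <;> simp [State.init, OnState.init, cost]

lemma State.Valid.on_subset_edgeSet (hσ : σ.Valid G c γ) :
    (σ.on.F : Set (Sym2 V)) ⊆ G.edgeSet :=
  subset_trans (by exact_mod_cast hσ.on_subset) hσ.subset_edgeSet

variable [DecidableEq V]

/-- In a major step a suitable `u` exists because `u = |Rh|` yields the empty set, as `γ ≥ 1`;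
`Nat.find` then supplies the least one. -/
lemma exists_step [Fintype V] (hPC : IsPrizeCollectingApprox G c γ PC)
    (hRh : ∀ q ∈ Rh, G.Reachable q.1 q.2 ∧ 0 < gdist G c q.1 q.2) (hγ : 1 ≤ γ) (σ : State V)
    (hr : G.Reachable r.1 r.2) : ∃ σ', Step G c γ PC Rh σ r σ' := by
  classical
  obtain ⟨on', hon⟩ := exists_onStep G (zeroOn c σ.S₀) σ.on hr
  rcases lt_or_ge (σ.B + cost (zeroOn c σ.S₀) (on'.F \ σ.on.F)) (2 * σ.Bh) with hlt | hge
  · exact ⟨_, .minor σ r on' _ hon rfl hlt⟩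
  have hex : ∃ u T, IsPartial γ PC Rh u T ∧
      cost c T ≤ 3 * γ * (σ.B + cost (zeroOn c σ.S₀) (on'.F \ σ.on.F)) :=
    ⟨Rh.length, ∅, Or.inl ⟨le_mul_of_one_le_left zero_le hγ, rfl⟩, by simp [cost]⟩
  obtain ⟨T, hT, hcT⟩ := Nat.find_spec hex
  refine ⟨_, .major σ r on' _ hon rfl hge (Nat.find hex) T ?_ hT hcT fun u' hu' => ?_⟩
  · exact Nat.find_min' hex
      ⟨∅, Or.inl ⟨le_mul_of_one_le_left zero_le hγ, rfl⟩, by simp [cost]⟩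
  · obtain ⟨T', hT'⟩ := exists_isPartial hPC hRh u'
    exact ⟨T', hT', not_le.1 fun h => Nat.find_min hex hu' ⟨T', hT', h⟩⟩

/-- An edge that is new to `S` is neither free for the current instance nor already bought by it, so
the instance is charged its full cost. -/
lemma State.Valid.cost_union_le (hσ : σ.Valid G c γ) (F : Finset (Sym2 V)) :
    cost c (σ.S ∪ F) ≤ cost c σ.S + cost (zeroOn c σ.S₀) (F \ σ.on.F) := by
  rw [← Finset.union_sdiff_self_eq_union]
  refine (SteinerForest.cost_union_le _ _).trans (add_le_add_right ?_ _)
  calc cost c (F \ σ.S) = cost (zeroOn c σ.S₀) (F \ σ.S) :=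
        Finset.sum_congr rfl fun e he => by
          have : e ∉ σ.S₀ := fun h => (Finset.mem_sdiff.1 he).2 (hσ.free_subset h)
          simp [zeroOn, this]
    _ ≤ _ := cost_mono (Finset.sdiff_subset_sdiff subset_rfl hσ.on_subset)

/-- In a major step the old term `6γ * Bh` is at most `3γ * B'` by doubling, and the partial
solution adds at most another `3γ * B'`. -/
lemma Step.valid (hPC : IsPrizeCollectingApprox G c γ PC) (hσ : σ.Valid G c γ)
    (h : Step G c γ PC Rh σ r σ') : σ'.Valid G c γ := by
  cases h with
  | minor on' B' hon hB hlt =>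
    refine ⟨?_, hσ.free_subset.trans Finset.subset_union_left, Finset.subset_union_right, ?_,
      hlt.le⟩
    · simp only [Finset.coe_union, Set.union_subset_iff]
      exact ⟨hσ.subset_edgeSet, hon.subset_edgeSet hσ.on_subset_edgeSet⟩
    · dsimp only
      refine (hσ.cost_union_le _).trans ?_
      rw [hB, add_right_comm]
      exact add_le_add_left hσ.cost_le _
  | major on' B' hon hB hge u T hu hT hcT hmin =>
    refine ⟨?_, subset_rfl, by simp [OnState.init], ?_, le_mul_of_one_le_left zero_le one_le_two⟩
    · simp only [Finset.coe_union, Set.union_subset_iff]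
      exact ⟨⟨hσ.subset_edgeSet, hon.subset_edgeSet hσ.on_subset_edgeSet⟩, IsPartial.subset hPC hT⟩
    · dsimp only
      have h₁ := hσ.cost_union_le on'.F
      have h₂ := hσ.cost_le
      have h₃ := SteinerForest.cost_union_le (c := c) (σ.S ∪ on'.F) T
      have h₄ : 3 * γ * (2 * σ.Bh) ≤ 3 * γ * B' := by gcongr
      rw [← NNReal.coe_le_coe] at h₁ h₂ h₃ h₄ hcT ⊢
      rw [← NNReal.coe_inj] at hB
      push_cast at h₁ h₂ h₃ h₄ hcT hB ⊢
      linarith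

lemma Step.subset (h : Step G c γ PC Rh σ r σ') : σ.S ⊆ σ'.S := by
  cases h <;> simp [Finset.union_assoc]

lemma Step.connects (h : Step G c γ PC Rh σ r σ') : Connects σ'.S r := by
  cases h with
  | minor on' B' hon => exact hon.connects.mono Finset.subset_union_right
  | major on' B' hon =>
    exact hon.connects.mono (Finset.subset_union_right.trans Finset.subset_union_left)

lemma Run.subset {R : List (V × V)} (h : Run G c γ PC Rh σ R σ') : σ.S ⊆ σ'.S := by
  induction h with
  | nil σ => exact subset_rfl
  | cons σ σ' σ'' r R hstep _ ih => exact hstep.subset.trans ih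

lemma Run.connects {R : List (V × V)} (h : Run G c γ PC Rh σ R σ') :
    ∀ r ∈ R, Connects σ'.S r := by
  induction h with
  | nil σ => simp
  | cons σ σ' σ'' r R hstep hrun ih =>
    intro q hq
    rcases List.mem_cons.1 hq with rfl | hq
    · exact hstep.connects.mono hrun.subset
    · exact ih q hq

lemma Run.valid (hPC : IsPrizeCollectingApprox G c γ PC) {R : List (V × V)}
    (h : Run G c γ PC Rh σ R σ') (hσ : σ.Valid G c γ) : σ'.Valid G c γ := by
  induction h with
  | nil σ => exact hσ
  | cons σ σ' σ'' r R hstep _ ih => exact ih (hstep.valid hPC hσ)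

/-! ## Phases of the framework -/

/-- Serving the requests `r a, …, r (b - 1)` from the initial state, the online algorithm may
reach the state `τ` at total cost `x`. -/
def OnRunTo (G : SimpleGraph V) (c : Sym2 V → ℝ≥0) (r : ℕ → V × V) (a b : ℕ) (τ : OnState V)
    (x : ℝ≥0) : Prop :=
  ∃ on : ℕ → OnState V, on a = OnState.init V ∧ on b = τ ∧
    (∀ j, a ≤ j → j < b → OnStep G c (on j) (r j) (on (j + 1))) ∧
    x = ∑ j ∈ Finset.Ico a b, cost c ((on (j + 1)).F \ (on j).F)

lemma OnRunTo.refl (r : ℕ → V × V) (a : ℕ) : OnRunTo G c r a a (OnState.init V) 0 :=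
  ⟨fun _ => OnState.init V, rfl, rfl, fun _ _ _ => by omega, by simp⟩

lemma OnRunTo.snoc {r : ℕ → V × V} {a b : ℕ} {τ τ' : OnState V} {x : ℝ≥0} (hab : a ≤ b)
    (h : OnRunTo G c r a b τ x) (hstep : OnStep G c τ (r b) τ') :
    OnRunTo G c r a (b + 1) τ' (x + cost c (τ'.F \ τ.F)) := by
  obtain ⟨on, h0, hb, hon, hx⟩ := h
  have hne : ∀ {j}, j ≤ b → Function.update on (b + 1) τ' j = on j := fun hj =>
    Function.update_of_ne (by omega) _ _
  refine ⟨Function.update on (b + 1) τ', ?_, Function.update_self _ _ _, fun j haj hjb => ?_, ?_⟩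
  · rw [hne hab, h0]
  · rcases Nat.lt_succ_iff_lt_or_eq.1 hjb with hlt | rfl
    · rw [hne hlt.le, hne hlt]
      exact hon j haj hlt
    · rw [hne le_rfl, Function.update_self, hb]
      exact hstep
  · rw [Finset.sum_Ico_succ_top hab, hne le_rfl, Function.update_self, hb, hx]
    congr 1
    refine Finset.sum_congr rfl fun j hj => ?_
    have hj' := (Finset.mem_Ico.1 hj).2
    rw [hne hj'.le, hne hj']

/-- The state `σ` is reached after `i` requests; the current phase started with a budget of at
most `W` or with a good set of free edges, and no budget exceeds `M`. -/
structure PhaseInvariant (G : SimpleGraph V) (c : Sym2 V → ℝ≥0) (r : ℕ → V × V)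
    (Good : Finset (Sym2 V) → Prop) (W M : ℝ) (i : ℕ) (σ : State V) : Prop where
  phase : ∃ a ≤ i, ∃ x, OnRunTo G (zeroOn c σ.S₀) r a i σ.on x ∧ σ.B = σ.Bh + x
  good : (σ.Bh : ℝ) ≤ W ∨ Good σ.S₀
  bound : (σ.Bh : ℝ) ≤ M

variable {rs : ℕ → V × V} {Good : Finset (Sym2 V) → Prop} {W X Z : ℝ} {n i : ℕ}

lemma Step.phaseInvariant (hPC : IsPrizeCollectingApprox G c γ PC) (hσ : σ.Valid G c γ)
    (hX0 : 0 ≤ X) (hW0 : 0 ≤ W) (hZ0 : 0 ≤ Z)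
    (hX : ∀ j < n, gdist G c (rs j).1 (rs j).2 ≤ ENNReal.ofReal X)
    (hZ : ∀ S₀ a b τ x, Good S₀ → b ≤ n → OnRunTo G (zeroOn c S₀) rs a b τ x → (x : ℝ) ≤ Z)
    (hGood : ∀ (B' : ℝ≥0) u T S₁, W ≤ B' → IsPartial γ PC Rh u T →
      (∀ u' < u, ∃ T', IsPartial γ PC Rh u' T' ∧ 3 * γ * B' < cost c T') → T ⊆ S₁ →
      (S₁ : Set (Sym2 V)) ⊆ G.edgeSet → Good S₁)
    (hi : i < n) (hinv : PhaseInvariant G c rs Good W (2 * W + 2 * X + 2 * Z) i σ)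
    (h : Step G c γ PC Rh σ (rs i) σ') :
    PhaseInvariant G c rs Good W (2 * W + 2 * X + 2 * Z) (i + 1) σ' := by
  obtain ⟨a, ha, x, hrun, hBx⟩ := hinv.phase
  have hvalid := h.valid hPC hσ
  cases h with
  | minor on' B' hon hB hlt =>
    refine ⟨⟨a, by omega, _, hrun.snoc ha hon, ?_⟩, hinv.good, hinv.bound⟩
    rw [hB, hBx, add_assoc]
  | major on' B' hon hB hge u T hu hT hcT hmin =>
    have hinc : (cost (zeroOn c σ.S₀) (on'.F \ σ.on.F) : ℝ) ≤ 2 * X := by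
      have h₁ := (hon.cost_le hσ.on_subset_edgeSet).trans
        (mul_le_mul' le_rfl ((gdist_mono (zeroOn_le c _) _ _).trans (hX i hi)))
      have h₂ := ENNReal.toReal_mono (by finiteness) h₁
      simpa [ENNReal.toReal_mul, ENNReal.toReal_ofReal hX0] using h₂
    refine ⟨⟨i + 1, le_rfl, 0, OnRunTo.refl _ _, (add_zero _).symm⟩, ?_, ?_⟩
    · rcases le_total (B' : ℝ) W with hle | hle
      · exact Or.inl hle
      · exact Or.inr (hGood B' u T _ hle hT hmin Finset.subset_union_right hvalid.subset_edgeSet)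
    · dsimp only
      have hbud : (σ.B : ℝ) ≤ 2 * σ.Bh := by exact_mod_cast hσ.budget
      have hB' : (B' : ℝ) = σ.B + cost (zeroOn c σ.S₀) (on'.F \ σ.on.F) := by exact_mod_cast hB
      -- Either the old budget is at most `W`, and `B'` exceeds its double by at most the last
      -- step's `2X`; or the phase is good, and `2 * Bh ≤ B' = Bh + (phase cost)` with phase cost at
      -- most `Z` gives `B' ≤ 2Z`.
      rcases hinv.good with hle | hgood
      · linarith
      · have hx := hZ _ _ _ _ _ hgood (Nat.succ_le_of_lt hi) (hrun.snoc ha hon)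
        push_cast at hx
        have hBx' : (σ.B : ℝ) = σ.Bh + x := by exact_mod_cast hBx
        have hge' : (2 * σ.Bh : ℝ) ≤ B' := by exact_mod_cast hge
        linarith

lemma Run.phaseInvariant (hPC : IsPrizeCollectingApprox G c γ PC)
    (hX0 : 0 ≤ X) (hW0 : 0 ≤ W) (hZ0 : 0 ≤ Z)
    (hX : ∀ j < n, gdist G c (rs j).1 (rs j).2 ≤ ENNReal.ofReal X)
    (hZ : ∀ S₀ a b τ x, Good S₀ → b ≤ n → OnRunTo G (zeroOn c S₀) rs a b τ x → (x : ℝ) ≤ Z)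
    (hGood : ∀ (B' : ℝ≥0) u T S₁, W ≤ B' → IsPartial γ PC Rh u T →
      (∀ u' < u, ∃ T', IsPartial γ PC Rh u' T' ∧ 3 * γ * B' < cost c T') → T ⊆ S₁ →
      (S₁ : Set (Sym2 V)) ⊆ G.edgeSet → Good S₁)
    {R : List (V × V)} (h : Run G c γ PC Rh σ R σ') (hσ : σ.Valid G c γ)
    (hR : ∀ j (hj : j < R.length), R[j] = rs (i + j)) (hi : i + R.length ≤ n)
    (hinv : PhaseInvariant G c rs Good W (2 * W + 2 * X + 2 * Z) i σ) :
    PhaseInvariant G c rs Good W (2 * W + 2 * X + 2 * Z) (i + R.length) σ' := by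
  induction h generalizing i with
  | nil σ => exact hinv
  | cons σ σ' σ'' r R hstep _ ih =>
    have hr : r = rs i := hR 0 (by simp)
    subst hr
    rw [List.length_cons] at hi
    have := ih (i := i + 1) (hstep.valid hPC hσ)
      (fun j hj => by
        have := hR (j + 1) (by simpa using hj)
        rw [List.getElem_cons_succ] at this
        rw [this]
        congr 1
        omega)
      (by omega)
      (hstep.phaseInvariant hPC hσ hX0 hW0 hZ0 hX hZ hGood (by omega) hinv)
    rw [List.length_cons, Nat.add_comm R.length 1, ← Nat.add_assoc]
    exact this

/-- Here `X` bounds the distance of a request, `Z` the cost of a phase with good free edges, and `W`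
is a budget from which on every new phase is good. The predicate `Good` is left open so that both
bounds of the theorem follow. -/
lemma Run.cost_le (hPC : IsPrizeCollectingApprox G c γ PC)
    (hX0 : 0 ≤ X) (hW0 : 0 ≤ W) (hZ0 : 0 ≤ Z)
    {R : List (V × V)} (hR : ∀ j (hj : j < R.length), R[j] = rs j)
    (hX : ∀ j < R.length, gdist G c (rs j).1 (rs j).2 ≤ ENNReal.ofReal X)
    (hZ : ∀ S₀ a b τ x, Good S₀ → b ≤ R.length → OnRunTo G (zeroOn c S₀) rs a b τ x →
      (x : ℝ) ≤ Z)
    (hGood : ∀ (B' : ℝ≥0) u T S₁, W ≤ B' → IsPartial γ PC Rh u T →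
      (∀ u' < u, ∃ T', IsPartial γ PC Rh u' T' ∧ 3 * γ * B' < cost c T') → T ⊆ S₁ →
      (S₁ : Set (Sym2 V)) ⊆ G.edgeSet → Good S₁)
    (h : Run G c γ PC Rh (State.init V) R σ) :
    (cost c σ.S : ℝ) ≤ (2 + 6 * γ) * (2 * W + 2 * X + 2 * Z) := by
  have hinv := h.phaseInvariant hPC (i := 0) hX0 hW0 hZ0 hX hZ hGood State.valid_init
    (fun j hj => by rw [hR j hj, zero_add]) (by omega)
    ⟨⟨0, le_rfl, 0, OnRunTo.refl _ _, by simp [State.init]⟩, Or.inl (by simpa [State.init] using hW0),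
      by simp only [State.init, NNReal.coe_zero]; positivity⟩
  have hvalid := h.valid hPC State.valid_init
  have h₁ : (cost c σ.S : ℝ) ≤ σ.B + 6 * γ * σ.Bh := by exact_mod_cast hvalid.cost_le
  have h₂ : (σ.B : ℝ) ≤ 2 * σ.Bh := by exact_mod_cast hvalid.budget
  calc (cost c σ.S : ℝ) ≤ (2 + 6 * γ) * σ.Bh := by linarith
    _ ≤ _ := by gcongr; exact hinv.bound

end Framework

/-! ## Predictions with a metric error -/

section Error

variable {G : SimpleGraph V} {c : Sym2 V → ℝ≥0} {γ : ℝ≥0}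
  {PC : List (V × V) → (V × V → ℝ≥0) → Finset (Sym2 V)} {R Rh : List (V × V)}
  {r q : V × V}

open Classical in
-- Counting positions rather than pairs accounts for repeated requests and fits the matching, which
-- is between positions.
lemma unsatisfied_length (R : List (V × V)) (S : Finset (Sym2 V)) :
    (unsatisfied R S).length =
      (Finset.univ.filter fun i : Fin R.length => ¬ Connects S (R.get i)).card := by
  conv_lhs => rw [unsatisfied, ← List.map_get_finRange R, List.filter_map, List.length_map]
  rw [← List.toFinset_card_of_nodup ((List.nodup_finRange _).filter _)]
  congr 1
  ext i
  simp

/-- Travel from one end of `r` to an end of `q`, cross `q` for free, and return to the other end of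
`r`. -/
lemma gdist_zeroOn_le_matchCost [DecidableEq V] {S : Finset (Sym2 V)}
    (hS : (S : Set (Sym2 V)) ⊆ G.edgeSet) (hq : Connects S q) :
    gdist G (zeroOn c S) r.1 r.2 ≤ matchCost G c r q := by
  have hm := gdist_mono (G := G) (zeroOn_le c S)
  have h₀ : gdist G (zeroOn c S) q.1 q.2 = 0 := Connects.gdist_zeroOn hS hq subset_rfl
  refine le_min ?_ ?_
  · calc gdist G (zeroOn c S) r.1 r.2
        ≤ gdist G (zeroOn c S) r.1 q.1 + gdist G (zeroOn c S) q.1 r.2 := gdist_triangle _ _ _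
      _ ≤ gdist G (zeroOn c S) r.1 q.1 +
          (gdist G (zeroOn c S) q.1 q.2 + gdist G (zeroOn c S) q.2 r.2) := by
          gcongr; exact gdist_triangle _ _ _
      _ ≤ _ := by
          rw [h₀, zero_add, gdist_comm q.2]
          exact add_le_add (hm _ _) (hm _ _)
  · calc gdist G (zeroOn c S) r.1 r.2
        ≤ gdist G (zeroOn c S) r.1 q.2 + gdist G (zeroOn c S) q.2 r.2 := gdist_triangle _ _ _
      _ ≤ gdist G (zeroOn c S) r.1 q.2 +
          (gdist G (zeroOn c S) q.2 q.1 + gdist G (zeroOn c S) q.1 r.2) := by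
          gcongr; exact gdist_triangle _ _ _
      _ ≤ _ := by
          rw [gdist_comm q.2 q.1, h₀, zero_add]
          exact add_le_add (hm _ _) (hm _ _)

lemma exists_cost_le_gdist [Fintype V] [DecidableEq V] {u v : V} (h : gdist G c u v ≠ ∞) :
    ∃ Q : Finset (Sym2 V), (Q : Set (Sym2 V)) ⊆ G.edgeSet ∧ (cost c Q : ℝ≥0∞) ≤ gdist G c u v ∧
      Connects Q (u, v) := by
  obtain ⟨p, hp⟩ := exists_isShortestPath c (reachable_of_gdist_ne_top h)
  refine ⟨p.edges.toFinset, edges_toFinset_subset p, ?_, connects_of_walk p subset_rfl⟩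
  rw [← hp.walkCost_eq, walkCost, ← List.sum_toFinset _ hp.1.isTrail.edges_nodup, cost]

lemma exists_cost_le_matchCost [Fintype V] [DecidableEq V] (h : matchCost G c r q ≠ ∞) :
    ∃ Q : Finset (Sym2 V), (Q : Set (Sym2 V)) ⊆ G.edgeSet ∧ (cost c Q : ℝ≥0∞) ≤ matchCost G c r q ∧
      ∀ S, Connects S r → Q ⊆ S → Connects S q := by
  have key : ∀ q : V × V, gdist G c r.1 q.1 + gdist G c r.2 q.2 ≠ ∞ →
      ∃ Q : Finset (Sym2 V), (Q : Set (Sym2 V)) ⊆ G.edgeSet ∧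
        (cost c Q : ℝ≥0∞) ≤ gdist G c r.1 q.1 + gdist G c r.2 q.2 ∧
        ∀ S, Connects S r → Q ⊆ S → Connects S q := by
    intro q hq
    obtain ⟨h₁, h₂⟩ := ENNReal.add_ne_top.1 hq
    obtain ⟨Q₁, hE₁, hc₁, hQ₁⟩ := exists_cost_le_gdist h₁
    obtain ⟨Q₂, hE₂, hc₂, hQ₂⟩ := exists_cost_le_gdist h₂
    refine ⟨Q₁ ∪ Q₂, by simp [hE₁, hE₂], ?_, fun S hS hQ => ?_⟩
    · refine le_trans ?_ (add_le_add hc₁ hc₂)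
      exact_mod_cast cost_union_le Q₁ Q₂
    · exact ((hQ₁.mono (Finset.subset_union_left.trans hQ)).symm.trans hS).trans
        (hQ₂.mono (Finset.subset_union_right.trans hQ))
  rcases min_choice (gdist G c r.1 q.1 + gdist G c r.2 q.2)
    (gdist G c r.1 q.2 + gdist G c q.1 r.2) with hm | hm
  · rw [matchCost, hm] at h ⊢
    exact key q h
  · rw [matchCost, hm, gdist_comm q.1] at h ⊢
    obtain ⟨Q, hE, hc, hQ⟩ := key q.swap h
    exact ⟨Q, hE, hc, fun S hS hQS => (hQ S hS hQS).symm⟩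

lemma cost_biUnion_le [DecidableEq V] {ι : Type*} (s : Finset ι) (Q : ι → Finset (Sym2 V)) :
    cost c (s.biUnion Q) ≤ ∑ i ∈ s, cost c (Q i) := by
  classical
  induction s using Finset.induction_on with
  | empty => simp [cost]
  | insert i s hi ih =>
    rw [Finset.biUnion_insert, Finset.sum_insert hi]
    exact (cost_union_le _ _).trans (add_le_add_right ih _)

/-- A solution for `R` extends to the predictions matched with `R` at the cost of the matching. -/
lemma exists_solution_of_matching [Fintype V] [DecidableEq V] {Sopt : Finset (Sym2 V)}
    (hopt : IsFeasible G R Sopt) {A : Finset (Fin R.length)} {Ah : Finset (Fin Rh.length)}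
    (f : A ≃ Ah) {D : ℝ≥0}
    (hD : ∑ a : A, matchCost G c (R.get a.1) (Rh.get (f a).1) = D) :
    ∃ S : Finset (Sym2 V), (S : Set (Sym2 V)) ⊆ G.edgeSet ∧ cost c S ≤ cost c Sopt + D ∧
      (unsatisfied Rh S).length ≤ Ahᶜ.card := by
  classical
  have hne : ∀ a : A, matchCost G c (R.get a.1) (Rh.get (f a).1) ≠ ∞ := fun a =>
    ne_top_of_le_ne_top (ENNReal.coe_ne_top (r := D))
      (hD ▸ Finset.single_le_sum (f := fun a : A => matchCost G c (R.get a.1) (Rh.get (f a).1))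
        (fun _ _ => zero_le) (Finset.mem_univ a))
  choose Q hE hc hQ using fun a => exists_cost_le_matchCost (hne a)
  refine ⟨Sopt ∪ Finset.univ.biUnion Q, ?_, ?_, ?_⟩
  · simp only [Finset.coe_union, Set.union_subset_iff, Finset.coe_biUnion, Set.iUnion_subset_iff]
    exact ⟨hopt.1, fun a _ => hE a⟩
  · refine (cost_union_le _ _).trans (add_le_add_right ?_ _)
    refine (cost_biUnion_le Finset.univ Q).trans ?_
    rw [← ENNReal.coe_le_coe, ← hD, ENNReal.ofNNReal_finsetSum]
    exact Finset.sum_le_sum fun a _ => hc a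
  · rw [unsatisfied_length]
    refine Finset.card_le_card fun i hi => ?_
    rw [Finset.mem_compl]
    intro hiA
    refine (Finset.mem_filter.1 hi).2 ?_
    have := hQ (f.symm ⟨i, hiA⟩) (Sopt ∪ Finset.univ.biUnion Q)
      ((hopt.2 _ (List.get_mem _ _)).mono Finset.subset_union_left)
      ((Finset.subset_biUnion_of_mem Q (Finset.mem_univ _)).trans Finset.subset_union_right)
    simpa using this

lemma log_add_two_ge (x : ℝ) (hx : 0 ≤ x) : 0.69 ≤ Real.log (x + 2) :=
  le_trans (by linarith [Real.log_two_gt_d9]) (Real.log_le_log two_pos (by linarith))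

/-- In a phase, requests that are matched with satisfied predictions pay for the matching, and
the other requests pay as in the subset-competitive analysis of the online algorithm. -/
lemma OnRunTo.le_of_matching [DecidableEq V] {Sopt S₀ : Finset (Sym2 V)}
    (hopt : IsFeasible G R Sopt) {A : Finset (Fin R.length)} {Ah : Finset (Fin Rh.length)}
    (f : A ≃ Ah) {D : ℝ≥0}
    (hD : ∑ a : A, matchCost G c (R.get a.1) (Rh.get (f a).1) = D)
    (hS₀ : (S₀ : Set (Sym2 V)) ⊆ G.edgeSet) {rs : ℕ → V × V}
    (hR : ∀ j (hj : j < R.length), R[j] = rs j) {a b : ℕ} (hb : b ≤ R.length) {τ : OnState V}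
    {x : ℝ≥0} (h : OnRunTo G (zeroOn c S₀) rs a b τ x) :
    (x : ℝ) ≤ 2 * D +
      100 * Real.log ((Aᶜ.card + (unsatisfied Rh S₀).length : ℕ) + 2) * cost c Sopt := by
  classical
  obtain ⟨on, h0, -, hon, rfl⟩ := h
  have hget : ∀ j : Fin R.length, R.get j = rs j := fun j => hR j j.2
  have hconn : ∀ j, a ≤ j → j < b → Connects Sopt (rs j) := fun j _ hj => by
    rw [← hR j (by omega)]
    exact hopt.2 _ (List.getElem_mem _)
  set inc : ℕ → ℝ≥0 := fun j => cost (zeroOn c S₀) ((on (j + 1)).F \ (on j).F) with hinc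
  set good : ℕ → Prop := fun j => ∃ i : A, i.1.1 = j ∧ Connects S₀ (Rh.get (f i).1) with hgood
  have hgoodsum : ((∑ j ∈ (Finset.Ico a b).filter good, inc j : ℝ≥0) : ℝ) ≤ 2 * D := by
    have : ((∑ j ∈ (Finset.Ico a b).filter good, inc j : ℝ≥0) : ℝ≥0∞) ≤ 2 * D := by
      rw [ENNReal.ofNNReal_finsetSum, ← hD]
      -- Each good step is charged to its own matched position; in the double sum, each matched
      -- position is then charged at most once.
      calc ∑ j ∈ (Finset.Ico a b).filter good, (inc j : ℝ≥0∞)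
          ≤ ∑ j ∈ (Finset.Ico a b).filter good, ∑ i : A,
              if i.1.1 = j then 2 * matchCost G c (R.get i.1) (Rh.get (f i).1) else 0 := by
            refine Finset.sum_le_sum fun j hj => ?_
            obtain ⟨hj, i, rfl, hi⟩ := Finset.mem_filter.1 hj
            obtain ⟨haj, hjb⟩ := Finset.mem_Ico.1 hj
            refine le_trans ?_ (Finset.single_le_sum (fun _ _ => zero_le) (Finset.mem_univ i))
            rw [if_pos rfl]
            refine ((hon _ haj hjb).cost_le (onRun_subset_edgeSet h0 hon haj hjb.le)).trans
              (mul_le_mul' le_rfl ?_)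
            rw [← hget i.1]
            exact gdist_zeroOn_le_matchCost hS₀ hi
        _ ≤ ∑ i : A, 2 * matchCost G c (R.get i.1) (Rh.get (f i).1) := by
            rw [Finset.sum_comm]
            refine Finset.sum_le_sum fun i _ => ?_
            rw [Finset.sum_ite_eq]
            split_ifs <;> simp
        _ = _ := by rw [Finset.mul_sum]
    exact_mod_cast this
  have hbadcard : ((Finset.Ico a b).filter (¬ good ·)).card ≤
      Aᶜ.card + (unsatisfied Rh S₀).length := by
    -- A bad request is either unmatched or matched with an unsatisfied prediction, and `f` is
    -- injective on the latter kind.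
    have hsub : (Finset.Ico a b).filter (¬ good ·) ⊆ Aᶜ.image Fin.val ∪
        (Finset.univ.filter fun i : A => ¬ Connects S₀ (Rh.get (f i).1)).image (·.1.1) := by
      intro j hj
      obtain ⟨hj, hbad⟩ := Finset.mem_filter.1 hj
      have hjn : j < R.length := by have := (Finset.mem_Ico.1 hj).2; omega
      rw [Finset.mem_union, Finset.mem_image, Finset.mem_image]
      by_cases hjA : (⟨j, hjn⟩ : Fin R.length) ∈ A
      · refine Or.inr ⟨⟨⟨j, hjn⟩, hjA⟩, ?_, rfl⟩
        rw [Finset.mem_filter]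
        exact ⟨Finset.mem_univ _, fun h => hbad ⟨⟨⟨j, hjn⟩, hjA⟩, rfl, h⟩⟩
      · exact Or.inl ⟨⟨j, hjn⟩, Finset.mem_compl.2 hjA, rfl⟩
    refine (Finset.card_le_card hsub).trans ((Finset.card_union_le _ _).trans
      (add_le_add Finset.card_image_le (Finset.card_image_le.trans ?_)))
    rw [unsatisfied_length]
    refine Finset.card_le_card_of_injOn (fun i => (f i).1) (fun i hi => ?_) fun i _ j _ hij => ?_
    · simpa using hi
    · exact f.injective (Subtype.ext hij)
  have hbadsum := onRun_sum_cost_le h0 hon hopt.1 hconn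
    (P := (Finset.Ico a b).filter (¬ good ·)) (Finset.filter_subset _ _)
  rw [← Finset.sum_filter_add_sum_filter_not _ good, NNReal.coe_add]
  refine add_le_add hgoodsum ?_
  rw [NNReal.coe_sum]
  refine hbadsum.trans ?_
  have hlog := log_add_two_ge (Aᶜ.card + (unsatisfied Rh S₀).length : ℕ) (by positivity)
  gcongr
  exact cost_le_cost (zeroOn_le c S₀) Sopt

lemma exists_request_seq {R : List (V × V)} (hR : R ≠ []) :
    ∃ rs : ℕ → V × V, ∀ j (hj : j < R.length), R[j] = rs j :=
  ⟨fun j => R.getD j (R.head hR), fun j hj => by simp [hj]⟩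

lemma gdist_le_of_isFeasible [DecidableEq V] {Sopt : Finset (Sym2 V)} (hopt : IsFeasible G R Sopt)
    {rs : ℕ → V × V} (hR : ∀ j (hj : j < R.length), R[j] = rs j) :
    ∀ j < R.length, gdist G c (rs j).1 (rs j).2 ≤ ENNReal.ofReal (cost c Sopt) := by
  intro j hj
  rw [ENNReal.ofReal_coe_nnreal, ← hR j hj]
  exact Connects.gdist_le hopt.1 (hopt.2 _ (List.getElem_mem _))

/-- Every phase counts as good, with `W = 0`: the subset bound is applied to all requests of a
phase, and the predictions play no role. -/
lemma Run.cost_le_length [DecidableEq V] (hPC : IsPrizeCollectingApprox G c γ PC)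
    {Sopt : Finset (Sym2 V)} (hopt : IsFeasible G R Sopt) (hne : R ≠ []) {σ : State V}
    (h : Run G c γ PC Rh (State.init V) R σ) :
    (cost c σ.S : ℝ) ≤
      (2 + 6 * γ) * (203 * Real.log (R.length + 2) * cost c Sopt) := by
  obtain ⟨rs, hR⟩ := exists_request_seq hne
  have hlog := log_add_two_ge R.length (by positivity)
  have hX0 : (0 : ℝ) ≤ cost c Sopt := NNReal.coe_nonneg _
  have := h.cost_le hPC (Good := fun _ => True) (W := 0) (X := cost c Sopt)
    (Z := 100 * Real.log (R.length + 2) * cost c Sopt) hX0 le_rfl (by positivity) hR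
    (gdist_le_of_isFeasible hopt hR)
    (fun S₀ a b τ x _ hb hrun => by
      obtain ⟨on, h0, -, hon, rfl⟩ := hrun
      rw [NNReal.coe_sum]
      refine (onRun_sum_cost_le h0 hon hopt.1 (fun j _ hj => ?_) subset_rfl).trans ?_
      · rw [← hR j (by omega)]
        exact hopt.2 _ (List.getElem_mem _)
      · rw [Nat.card_Ico]
        gcongr
        · omega
        · exact cost_le_cost (zeroOn_le c S₀) Sopt)
    (fun _ _ _ _ _ _ _ _ _ => trivial)
  refine this.trans ?_
  gcongr
  have : (1 : ℝ) * cost c Sopt ≤ 1.5 * Real.log (R.length + 2) * cost c Sopt := by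
    gcongr
    linarith
  linarith

lemma Run.cost_le_error [Fintype V] [DecidableEq V] (hPC : IsPrizeCollectingApprox G c γ PC)
    (hγ : 1 ≤ γ) {Sopt : Finset (Sym2 V)} (hopt : IsFeasible G R Sopt) (hne : R ≠ [])
    {Δ : ℕ} {D : ℝ≥0} (herr : IsMetricError G c R Rh Δ D) {σ : State V}
    (h : Run G c γ PC Rh (State.init V) R σ) :
    (cost c σ.S : ℝ) ≤
      (2 + 6 * γ) * ((206 + 600 * γ) * Real.log (Δ + 2) * cost c Sopt + 6 * D) := by
  obtain ⟨A, Ah, -, ⟨⟨f, hf⟩, -⟩, hΔ⟩ := herr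
  obtain ⟨rs, hR⟩ := exists_request_seq hne
  obtain ⟨S, hSE, hSc, hSu⟩ := exists_solution_of_matching hopt f hf.symm
  have hlog := log_add_two_ge Δ (by positivity)
  have hX0 : (0 : ℝ) ≤ cost c Sopt := NNReal.coe_nonneg _
  have hγ' : (1 : ℝ) ≤ γ := by exact_mod_cast hγ
  -- The additive `2γ` from `log (1 + 2γ)` is absorbed because `log (Δ + 2) ≥ 0.69 > 2/3`.
  have hlog' : Real.log ((1 + 2 * γ) * Δ + 2) ≤ (1 + 3 * γ) * Real.log (Δ + 2) := by
    calc Real.log ((1 + 2 * γ) * Δ + 2) ≤ Real.log ((1 + 2 * γ) * (Δ + 2)) :=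
          Real.log_le_log (by positivity) (by linarith)
      _ = Real.log (1 + 2 * γ) + Real.log (Δ + 2) := Real.log_mul (by positivity) (by positivity)
      _ ≤ 2 * γ + Real.log (Δ + 2) := by
          have := Real.log_le_sub_one_of_pos (by positivity : (0 : ℝ) < 1 + 2 * γ)
          linarith
      _ ≤ _ := by nlinarith
  have hlog0 : 0 ≤ Real.log ((1 + 2 * γ) * Δ + 2) :=
    Real.log_nonneg (by have : (0 : ℝ) ≤ (1 + 2 * γ) * Δ := by positivity
                        linarith)
  have := h.cost_le hPC
    (Good := fun S₀ => (S₀ : Set (Sym2 V)) ⊆ G.edgeSet ∧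
      ((unsatisfied Rh S₀).length : ℝ) ≤ 2 * γ * Δ)
    (W := cost c Sopt + D) (X := cost c Sopt)
    (Z := 2 * D + 100 * Real.log ((1 + 2 * γ) * Δ + 2) * cost c Sopt)
    hX0 (by positivity) (by positivity) hR (gdist_le_of_isFeasible hopt hR)
    (fun S₀ a b τ x hgood hb hrun => by
      refine (hrun.le_of_matching hopt f hf.symm hgood.1 hR hb).trans ?_
      have hA : (Aᶜ.card : ℝ) ≤ Δ := by exact_mod_cast (by omega : Aᶜ.card ≤ Δ)
      have := hgood.2
      gcongr
      push_cast
      linarith)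
    (fun B' u T S₁ hB' hT hmin hTS hS₁ => by
      refine ⟨hS₁, ?_⟩
      -- The set `S` built from the matching misses at most `Δ` predictions and costs at most `OPT +
      -- D ≤ B'`. So `Partial` at `Δ` fits the budget, and the least `u` cannot be larger.
      have hu : u ≤ Δ := by
        by_contra hlt
        obtain ⟨T', hT', hc'⟩ := hmin Δ (not_le.1 hlt)
        have h₁ := hT'.cost_le hPC hSE (by omega : _ ≤ Δ)
        have h₂ : (cost c S : ℝ) ≤ cost c Sopt + D := by exact_mod_cast hSc
        have h₃ : (3 * γ * B' : ℝ) < cost c T' := by exact_mod_cast hc'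
        have h₄ : (3 * γ * cost c S : ℝ) ≤ 3 * γ * B' := by gcongr; linarith
        linarith
      have h₁ : ((unsatisfied Rh S₁).length : ℝ) ≤ (unsatisfied Rh T).length := by
        classical
        rw [unsatisfied_length, unsatisfied_length]
        gcongr with i
        exact fun hc => hc.mono hTS
      refine h₁.trans (hT.unsatisfied_le.trans ?_)
      gcongr)
  refine this.trans (mul_le_mul_of_nonneg_left ?_ (by positivity))
  have h₁ : (1 : ℝ) * cost c Sopt ≤ 1.5 * Real.log (Δ + 2) * cost c Sopt := by
    gcongr
    linarith
  have h₂ : Real.log ((1 + 2 * γ) * Δ + 2) * cost c Sopt ≤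
      (1 + 3 * γ) * Real.log (Δ + 2) * cost c Sopt := by gcongr
  linarith

end Error

end SteinerForest

/-! ### Combining the bounds in the number of requests and in the error. -/

theorem mainTheorem2 (γ : ℝ≥0) (hγ : 1 ≤ γ) :
    ∃ C : ℝ, 0 < C ∧
      ∀ (V : Type*) [Fintype V] [DecidableEq V] (G : SimpleGraph V) (c : Sym2 V → ℝ≥0)
        (PC : List (V × V) → (V × V → ℝ≥0) → Finset (Sym2 V))
        (_ : SteinerForest.IsPrizeCollectingApprox G c γ PC)
        (Rh : List (V × V)),
        -- the algorithm never gets stuck, if the predicted pairs are connectable and nontrivial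
        ((∀ q ∈ Rh, G.Reachable q.1 q.2 ∧ 0 < SteinerForest.gdist G c q.1 q.2) →
          ∀ (R : List (V × V)) (σ : SteinerForest.State V),
            SteinerForest.Run G c γ PC Rh (SteinerForest.State.init V) R σ →
            ∀ r : V × V, G.Reachable r.1 r.2 →
              ∃ σ' : SteinerForest.State V, SteinerForest.Step G c γ PC Rh σ r σ') ∧
        -- every run ends with a feasible solution, whose cost is bounded for every error
        (∀ (R : List (V × V)) (σ : SteinerForest.State V),
          SteinerForest.Run G c γ PC Rh (SteinerForest.State.init V) R σ →
          SteinerForest.IsFeasible G R σ.S ∧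
          ∀ (opt : ℝ≥0), SteinerForest.IsOpt G c R opt →
          ∀ (Δ : ℕ) (D : ℝ≥0), SteinerForest.IsMetricError G c R Rh Δ D →
            (SteinerForest.cost c σ.S : ℝ) ≤
              C * Real.log (min (R.length : ℝ) (Δ : ℝ) + 2) * opt + C * D) := by
  refine ⟨(2 + 6 * γ) * (206 + 600 * γ), by positivity, ?_⟩
  intro V _ _ G c PC hPC Rh
  refine ⟨fun hRh R σ _ r hr => SteinerForest.exists_step hPC hRh hγ σ hr, fun R σ hrun => ?_⟩
  refine ⟨⟨(hrun.valid hPC SteinerForest.State.valid_init).subset_edgeSet, hrun.connects⟩, ?_⟩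
  rintro _ ⟨⟨Sopt, hopt, rfl⟩, -⟩ Δ D herr
  have hlog := SteinerForest.log_add_two_ge (min (R.length : ℝ) Δ) (by positivity)
  rcases eq_or_ne R [] with rfl | hne
  · cases hrun
    simp only [SteinerForest.State.init, SteinerForest.cost, Finset.sum_empty, NNReal.coe_zero]
    positivity
  have hγ0 : (0 : ℝ) ≤ γ := NNReal.coe_nonneg _
  have hD0 : (0 : ℝ) ≤ D := NNReal.coe_nonneg _
  rcases le_total (R.length : ℝ) Δ with hle | hle
  · rw [min_eq_left hle] at hlog ⊢
    refine (hrun.cost_le_length hPC hopt hne).trans (le_add_of_le_of_nonneg ?_ (by positivity))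
    rw [mul_assoc (2 + 6 * (γ : ℝ)), mul_assoc (2 + 6 * (γ : ℝ))]
    gcongr
    linarith
  · rw [min_eq_right hle] at hlog ⊢
    refine (hrun.cost_le_error hPC hγ hopt hne herr).trans ?_
    rw [mul_assoc (2 + 6 * (γ : ℝ)), mul_assoc (2 + 6 * (γ : ℝ)), mul_assoc (2 + 6 * (γ : ℝ)),
      ← mul_add]
    gcongr
    linarith
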